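/- Let $\Bbbk$ be a field, $k\ge 1$ an integer and $d\in\mathbb Z$. For a finite set $I$ let $\mathcal A^k_d(I)$ be the graded commutative unital $\Bbbk$-algebra (meaning $ab=(-1)^{|a||b|}ba$) generated by elements $\omega_S$ of degree $kd-1$, indexed by the linearly ordered subsets $S\subset I$ of cardinality $k+1$, subject to the relations \[ \omega_{\sigma(S)}=(-1)^{d|\sigma|}\omega_S\ (\sigma\in\mathbb S_{k+1}),\qquad \omega_S\,\omega_T=0\ \text{ if } |S\cap T|>1, \] \[ \sum_{m\in\mathbb Z/(2k+1)}\omega_{(i_{m+1},\ldots,i_{m+k+1})}\,\omega_{(i_{m+k+1},\ldots,i_{m+2k+1})}=0 \] for all pairwise distinct $i_1,\dots,i_{2k+1}\in I$ (indices of $i$ are taken modulo $2k+1$). Then the collection $\mathcal A^k_d$ is a Hopf cooperad, i.e. a counital symmetric cooperad in the symmetric monoidal category of graded commutative algebras (with the Koszul sign rule). More precisely, there is exactly one such structure (relabellings, a counit $\mathcal A^k_d(\{*\})\to\Bbbk$, and partial cocompositions $\varphi^{I,J}$, all of them degree-preserving morphisms of unital algebras) in which a bijection $e:I\to J$ acts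 by $\omega_S\mapsto\omega_{e(S)}$, where $e(S)$ has the linear order transported along $e$, and in which the partial cocompositions \[ \varphi^{I,J}:\mathcal A^k_d(I\sqcup J)\to\mathcal A^k_d(I\sqcup\{*\})\otimes\mathcal A^k_d(J) \] (for all finite sets $I,J$, possibly empty) are given on the generators by \[ \varphi^{I,J}(\omega_S)=\begin{cases}\omega_S\otimes 1 & \text{if } S\subset I,\\ 1\otimes\omega_S & \text{if } S\subset J,\\ \omega_{S\setminus\{s\}\sqcup\{*\}}\otimes 1 & \text{if } S\cap J=\{s\},\\ 0 & \text{if } |S\cap I|\ge 1 \text{ and } |S\cap J|\ge 2,\end{cases} \] where in the third case $*$ takes the position of $s$ in the linear order. In particular these formulas are compatible with the defining relations. -/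

import Mathlib

open scoped TensorProduct DirectSum

universe u v w

noncomputable section

/-! ### Hopf cooperads: cooperads in the category of graded commutative algebras -/

section HopfCooperad

/-- `Option (I ⊕ J) ≃ I ⊕ Option J`: the extra point is added to `J`. -/
def optionSumRight (I J : Type u) : Option (I ⊕ J) ≃ I ⊕ Option J where
  toFun
    | none => Sum.inr none
    | some (Sum.inl i) => Sum.inl i
    | some (Sum.inr j) => Sum.inr (some j)
  invFun
    | Sum.inl i => some (Sum.inl i)
    | Sum.inr none => none
    | Sum.inr (some j) => some (Sum.inr j)
  left_inv := by rintro (_ | _ | _) <;> rfl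
  right_inv := by rintro (_ | _ | _) <;> rfl

/-- `Option (I ⊕ J) ≃ Option I ⊕ J`: the extra point is added to `I`. -/
def optionSumLeft (I J : Type u) : Option (I ⊕ J) ≃ Option I ⊕ J where
  toFun
    | none => Sum.inl none
    | some (Sum.inl i) => Sum.inl (some i)
    | some (Sum.inr j) => Sum.inr j
  invFun
    | Sum.inl none => none
    | Sum.inl (some i) => some (Sum.inl i)
    | Sum.inr j => some (Sum.inr j)
  left_inv := by rintro (_ | _ | _) <;> rfl
  right_inv := by rintro ((_ | _) | _) <;> rfl

/-- Exchange of the two extra points of `I ⊔ {*} ⊔ {*'}`. -/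
def optionSwap (I : Type u) : Option (Option I) ≃ Option (Option I) where
  toFun
    | none => some none
    | some none => none
    | some (some i) => some (some i)
  invFun
    | none => some none
    | some none => none
    | some (some i) => some (some i)
  left_inv := by rintro (_ | _ | _) <;> rfl
  right_inv := by rintro (_ | _ | _) <;> rfl

/-- `(I ⊔ J) ⊔ L ≃ (I ⊔ L) ⊔ J`. -/
def sumRightComm (I J L : Type u) : (I ⊕ J) ⊕ L ≃ (I ⊕ L) ⊕ J where
  toFun
    | Sum.inl (Sum.inl i) => Sum.inl (Sum.inl i)
    | Sum.inl (Sum.inr j) => Sum.inr j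
    | Sum.inr l => Sum.inl (Sum.inr l)
  invFun
    | Sum.inl (Sum.inl i) => Sum.inl (Sum.inl i)
    | Sum.inl (Sum.inr l) => Sum.inr l
    | Sum.inr j => Sum.inl (Sum.inr j)
  left_inv := by rintro ((_ | _) | _) <;> rfl
  right_inv := by rintro ((_ | _) | _) <;> rfl

/-- The component of total degree `n` of the tensor product of two graded vector spaces. -/
def tensorDegree {K : Type v} {A B : Type w} [Field K] [Ring A] [Algebra K A] [Ring B]
    [Algebra K B] (𝒜 : ℤ → Submodule K A) (ℬ : ℤ → Submodule K B) (n : ℤ) :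
    Submodule K (A ⊗[K] B) :=
  Submodule.span K {x | ∃ i j : ℤ, i + j = n ∧ ∃ a ∈ 𝒜 i, ∃ b ∈ ℬ j, x = a ⊗ₜ[K] b}

/-- The symmetry `a ⊗ b ↦ (-1)^(deg a * deg b) b ⊗ a` on the underlying vector spaces. -/
def koszulSwap {K : Type v} {A B : Type w} [Field K] [Ring A] [Algebra K A] [Ring B]
    [Algebra K B] (𝒜 : ℤ → Submodule K A) (ℬ : ℤ → Submodule K B) [GradedAlgebra 𝒜]
    [GradedAlgebra ℬ] : A ⊗[K] B →ₗ[K] B ⊗[K] A :=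
  (GradedTensorProduct.of K ℬ 𝒜).symm.toLinearMap ∘ₗ
    (GradedTensorProduct.comm (R := K) 𝒜 ℬ).toLinearMap ∘ₗ
      (GradedTensorProduct.of K 𝒜 ℬ).toLinearMap

/-- The operations of a Hopf cooperad on a family of graded algebras `A I`, `I` a finite set:
relabelling along bijections, partial cocompositions
`φ^{I,J} : A (I ⊔ J) → A (I ⊔ {*}) ⊗ A J` and a counit `A {*} → K`. All of them are morphisms of
unital algebras, the target of `φ^{I,J}` being the tensor product of graded algebras (with the
Koszul sign in its multiplication). The set `I ⊔ {*}` is `Option I`. -/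
structure HopfCooperadOps (K : Type v) [Field K] (A : Type u → Type w) [∀ I, Ring (A I)]
    [∀ I, Algebra K (A I)] (𝒜 : ∀ I, ℤ → Submodule K (A I)) [∀ I, GradedAlgebra (𝒜 I)] where
  /-- relabelling -/
  relabel : ∀ {I J : Type u} [Finite I] [Finite J], (I ≃ J) → (A I →ₐ[K] A J)
  /-- partial cocomposition -/
  cocomp : ∀ (I J : Type u) [Finite I] [Finite J],
    A (I ⊕ J) →ₐ[K] GradedTensorProduct K (𝒜 (Option I)) (𝒜 J)
  /-- counit -/
  counit : A PUnit.{u + 1} →ₐ[K] K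

namespace HopfCooperadOps

variable {K : Type v} [Field K] {A : Type u → Type w} [∀ I, Ring (A I)] [∀ I, Algebra K (A I)]
  {𝒜 : ∀ I, ℤ → Submodule K (A I)} [∀ I, GradedAlgebra (𝒜 I)]

/-- Relabelling as a linear map. -/
def relabelLin (P : HopfCooperadOps K A 𝒜) {I J : Type u} [Finite I] [Finite J] (e : I ≃ J) :
    A I →ₗ[K] A J :=
  (P.relabel e).toLinearMap

/-- The partial cocomposition as a linear map to the underlying tensor product. -/
def cocompLin (P : HopfCooperadOps K A 𝒜) (I J : Type u) [Finite I] [Finite J] :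
    A (I ⊕ J) →ₗ[K] A (Option I) ⊗[K] A J :=
  (GradedTensorProduct.of K (𝒜 (Option I)) (𝒜 J)).symm.toLinearMap ∘ₗ (P.cocomp I J).toLinearMap

end HopfCooperadOps

/-- A Hopf cooperad structure on a family of graded algebras: a (counital, symmetric) cooperad,
in the partial cocomposition form, in the symmetric monoidal category of graded commutative
algebras. As all structure maps have degree zero, the coherence conditions are equalities of linear
maps between the underlying tensor products, with the Koszul sign only where factors are
exchanged. -/
structure HopfCooperad (K : Type v) [Field K] (A : Type u → Type w) [∀ I, Ring (A I)]
    [∀ I, Algebra K (A I)] (𝒜 : ∀ I, ℤ → Submodule K (A I)) [∀ I, GradedAlgebra (𝒜 I)]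
    extends HopfCooperadOps K A 𝒜 where
  /-- the algebras are graded commutative -/
  graded_comm : ∀ (I : Type u) [Finite I] (i j : ℤ), ∀ a ∈ 𝒜 I i, ∀ b ∈ 𝒜 I j,
    a * b = ((-1 : ℤˣ) ^ (i * j)) • (b * a)
  /-- the structure maps preserve degrees -/
  relabel_mem : ∀ {I J : Type u} [Finite I] [Finite J] (e : I ≃ J) (n : ℤ), ∀ a ∈ 𝒜 I n,
    relabel e a ∈ 𝒜 J n
  cocomp_mem : ∀ (I J : Type u) [Finite I] [Finite J] (n : ℤ), ∀ a ∈ 𝒜 (I ⊕ J) n,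
    toHopfCooperadOps.cocompLin I J a ∈ tensorDegree (𝒜 (Option I)) (𝒜 J) n
  counit_eq_zero : ∀ n : ℤ, n ≠ 0 → ∀ a ∈ 𝒜 PUnit.{u + 1} n, counit a = 0
  /-- relabelling is functorial -/
  relabel_refl : ∀ (I : Type u) [Finite I], relabel (Equiv.refl I) = AlgHom.id K (A I)
  relabel_trans : ∀ {I J L : Type u} [Finite I] [Finite J] [Finite L] (e : I ≃ J) (f : J ≃ L),
    relabel (e.trans f) = (relabel f).comp (relabel e)
  /-- the partial cocompositions are equivariant -/
  cocomp_relabel : ∀ {I I' J J' : Type u} [Finite I] [Finite I'] [Finite J] [Finite J']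
    (e : I ≃ I') (f : J ≃ J'),
    toHopfCooperadOps.cocompLin I' J' ∘ₗ toHopfCooperadOps.relabelLin (Equiv.sumCongr e f) =
      TensorProduct.map (toHopfCooperadOps.relabelLin (Equiv.optionCongr e))
        (toHopfCooperadOps.relabelLin f) ∘ₗ toHopfCooperadOps.cocompLin I J
  /-- left counit: `(ε ⊗ id) ∘ φ^{∅,J}` is the identification `A (∅ ⊔ J) = A J` -/
  counit_left : ∀ (J : Type u) [Finite J],
    (TensorProduct.lid K (A J)).toLinearMap ∘ₗ
        TensorProduct.map
          (counit.toLinearMap ∘ₗ toHopfCooperadOps.relabelLin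
            (Equiv.ofUnique (Option PEmpty.{u + 1}) PUnit.{u + 1}))
          LinearMap.id ∘ₗ
        toHopfCooperadOps.cocompLin PEmpty.{u + 1} J =
      toHopfCooperadOps.relabelLin (Equiv.emptySum PEmpty.{u + 1} J)
  /-- right counit: `(id ⊗ ε) ∘ φ^{I,{*}}` is the identification `A (I ⊔ {*}) = A (I ⊔ {*})` -/
  counit_right : ∀ (I : Type u) [Finite I],
    (TensorProduct.rid K (A (Option I))).toLinearMap ∘ₗ
        TensorProduct.map LinearMap.id counit.toLinearMap ∘ₗ
        toHopfCooperadOps.cocompLin I PUnit.{u + 1} =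
      toHopfCooperadOps.relabelLin (Equiv.optionEquivSumPUnit.{u} I).symm
  /-- sequential coassociativity: the two maps
  `A (I ⊔ J ⊔ L) → A (I ⊔ {*}) ⊗ (A (J ⊔ {*'}) ⊗ A L)` agree -/
  coassoc_seq : ∀ (I J L : Type u) [Finite I] [Finite J] [Finite L],
    TensorProduct.map LinearMap.id (toHopfCooperadOps.cocompLin J L) ∘ₗ
        toHopfCooperadOps.cocompLin I (J ⊕ L) =
      (TensorProduct.assoc K (A (Option I)) (A (Option J)) (A L)).toLinearMap ∘ₗ
        TensorProduct.map
          (toHopfCooperadOps.cocompLin I (Option J) ∘ₗ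
            toHopfCooperadOps.relabelLin (optionSumRight I J))
          LinearMap.id ∘ₗ
        toHopfCooperadOps.cocompLin (I ⊕ J) L ∘ₗ
        toHopfCooperadOps.relabelLin (Equiv.sumAssoc I J L).symm
  /-- parallel coassociativity: the two maps
  `A (I ⊔ J ⊔ L) → A (I ⊔ {*} ⊔ {*'}) ⊗ (A J ⊗ A L)` agree -/
  coassoc_par : ∀ (I J L : Type u) [Finite I] [Finite J] [Finite L],
    (TensorProduct.assoc K (A (Option (Option I))) (A J) (A L)).toLinearMap ∘ₗ
        TensorProduct.map
          (toHopfCooperadOps.cocompLin (Option I) J ∘ₗ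
            toHopfCooperadOps.relabelLin (optionSumLeft I J))
          LinearMap.id ∘ₗ
        toHopfCooperadOps.cocompLin (I ⊕ J) L =
      TensorProduct.map (toHopfCooperadOps.relabelLin (optionSwap I))
          (koszulSwap (𝒜 L) (𝒜 J)) ∘ₗ
        (TensorProduct.assoc K (A (Option (Option I))) (A L) (A J)).toLinearMap ∘ₗ
        TensorProduct.map
          (toHopfCooperadOps.cocompLin (Option I) L ∘ₗ
            toHopfCooperadOps.relabelLin (optionSumLeft I L))
          LinearMap.id ∘ₗ
        toHopfCooperadOps.cocompLin (I ⊕ L) J ∘ₗ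
        toHopfCooperadOps.relabelLin (sumRightComm I J L)

end HopfCooperad

/-! ### The generalized Orlik-Solomon algebras -/

section OrlikSolomon

variable (K : Type v) [Field K] (k : ℕ) (d : ℤ) (I : Type u)

/-- Points of the cyclically ordered list `i_0, …, i_{2k}`: the window of length `k + 1` starting
at position `m` (positions modulo `2k + 1`). -/
def cyclicWindow {k : ℕ} {I : Type u} (i : ZMod (2 * k + 1) ↪ I) (m : ZMod (2 * k + 1)) :
    Fin (k + 1) ↪ I where
  toFun j := i (m + ((j : ℕ) : ZMod (2 * k + 1)))
  inj' a b h := by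
    have h1 := add_left_cancel (i.injective h)
    rw [ZMod.natCast_eq_natCast_iff', Nat.mod_eq_of_lt (by omega), Nat.mod_eq_of_lt (by omega)] at h1
    exact Fin.ext h1

/-- The defining relations. A linearly ordered subset of cardinality `k + 1` is an injective map
from `Fin (k + 1)`. -/
inductive OSRel : FreeAlgebra K (Fin (k + 1) ↪ I) → FreeAlgebra K (Fin (k + 1) ↪ I) → Prop
  /-- `ω_{σ(S)} = (-1)^{d|σ|} ω_S` -/
  | symm (σ : Equiv.Perm (Fin (k + 1))) (s : Fin (k + 1) ↪ I) :
      OSRel (FreeAlgebra.ι K (σ.toEmbedding.trans s))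
        ((Equiv.Perm.sign σ ^ d) • FreeAlgebra.ι K s)
  /-- graded commutativity, the generators having degree `kd - 1` -/
  | comm (s t : Fin (k + 1) ↪ I) :
      OSRel (FreeAlgebra.ι K s * FreeAlgebra.ι K t)
        (((-1 : ℤˣ) ^ ((k * d - 1) * (k * d - 1) : ℤ)) • (FreeAlgebra.ι K t * FreeAlgebra.ι K s))
  /-- `ω_S ω_T = 0` if `|S ∩ T| > 1` -/
  | mul_zero (s t : Fin (k + 1) ↪ I) (h : 1 < (Set.range s ∩ Set.range t).ncard) :
      OSRel (FreeAlgebra.ι K s * FreeAlgebra.ι K t) 0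
  /-- `ω_{i_1 … i_{k+1}} ω_{i_{k+1} … i_{2k+1}}` + cyclic permutations `= 0` -/
  | cyclic (i : ZMod (2 * k + 1) ↪ I) :
      OSRel (∑ m : ZMod (2 * k + 1), FreeAlgebra.ι K (cyclicWindow i m) *
        FreeAlgebra.ι K (cyclicWindow i (m + (k : ZMod (2 * k + 1))))) 0

/-- The generalized Orlik-Solomon algebra `𝒜^k_d(I)`. -/
def OSAlgebra : Type (max u v) := RingQuot (OSRel K k d I)

instance : Ring (OSAlgebra K k d I) := inferInstanceAs (Ring (RingQuot (OSRel K k d I)))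

instance : Algebra K (OSAlgebra K k d I) :=
  inferInstanceAs (Algebra K (RingQuot (OSRel K k d I)))

namespace OSAlgebra

/-- The quotient map from the free algebra. -/
def mk : FreeAlgebra K (Fin (k + 1) ↪ I) →ₐ[K] OSAlgebra K k d I :=
  RingQuot.mkAlgHom K (OSRel K k d I)

variable {I} in
/-- The generator `ω_S`. -/
def ω (s : Fin (k + 1) ↪ I) : OSAlgebra K k d I := mk K k d I (FreeAlgebra.ι K s)

/-- The component of degree `n`: spanned by the products of `m` generators with
`m (kd - 1) = n`. -/
def degree (n : ℤ) : Submodule K (OSAlgebra K k d I) :=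
  Submodule.span K {x | ∃ l : List (Fin (k + 1) ↪ I),
    (l.length : ℤ) * (k * d - 1) = n ∧ x = (l.map (ω K k d)).prod}

theorem ω_mem (s : Fin (k + 1) ↪ I) : ω K k d s ∈ degree K k d I (k * d - 1) :=
  Submodule.subset_span ⟨[s], by simp, by simp⟩

instance : SetLike.GradedMonoid (degree K k d I) where
  one_mem := Submodule.subset_span ⟨[], by simp, by simp⟩
  mul_mem {i j} a b ha hb := by
    have h : degree K k d I i * degree K k d I j ≤ degree K k d I (i + j) := by
      rw [degree, degree, Submodule.span_mul_span]
      refine Submodule.span_le.2 ?_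
      rintro _ ⟨_, ⟨l, hl, rfl⟩, _, ⟨l', hl', rfl⟩, rfl⟩
      refine Submodule.subset_span ⟨l ++ l', ?_, by simp⟩
      rw [← hl, ← hl']
      simp [add_mul]
    exact h (Submodule.mul_mem_mul ha hb)

theorem mk_rel {x y : FreeAlgebra K (Fin (k + 1) ↪ I)} (h : OSRel K k d I x y) :
    mk K k d I x = mk K k d I y :=
  RingQuot.mkAlgHom_rel K h

/-- The generators as elements of the direct sum of the graded components. -/
def gen (s : Fin (k + 1) ↪ I) : ⨁ n, degree K k d I n :=
  DirectSum.of (fun n => degree K k d I n) (k * d - 1) ⟨ω K k d s, ω_mem K k d I s⟩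

theorem gen_mul (s t : Fin (k + 1) ↪ I) : gen K k d I s * gen K k d I t =
    DirectSum.of (fun n => degree K k d I n) ((k * d - 1) + (k * d - 1))
      ⟨ω K k d s * ω K k d t, SetLike.mul_mem_graded (ω_mem K k d I s) (ω_mem K k d I t)⟩ :=
  DirectSum.of_mul_of _ _

theorem gen_rel {x y : FreeAlgebra K (Fin (k + 1) ↪ I)} (h : OSRel K k d I x y) :
    FreeAlgebra.lift K (gen K k d I) x = FreeAlgebra.lift K (gen K k d I) y := by
  have h' := mk_rel K k d I h
  cases h with
  | symm σ s =>
    rcases Int.units_eq_one_or (Equiv.Perm.sign σ ^ d) with hc | hc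
    all_goals
      rw [hc] at h' ⊢
      simp only [one_smul, Units.neg_smul, map_neg, FreeAlgebra.lift_ι_apply] at h' ⊢
      simp only [gen, ← map_neg]
      congr 1
      exact Subtype.ext h'
  | comm s t =>
    rcases Int.units_eq_one_or ((-1 : ℤˣ) ^ ((k * d - 1) * (k * d - 1) : ℤ)) with hc | hc
    all_goals
      rw [hc] at h' ⊢
      simp only [one_smul, Units.neg_smul, map_neg, map_mul, FreeAlgebra.lift_ι_apply] at h' ⊢
      simp only [gen_mul, ← map_neg]
      congr 1
      exact Subtype.ext h'
  | mul_zero s t hst =>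
    simp only [map_mul, map_zero, FreeAlgebra.lift_ι_apply] at h' ⊢
    rw [gen_mul, ← (DirectSum.of (fun n => degree K k d I n)
      ((k * d - 1) + (k * d - 1))).map_zero]
    congr 1
    exact Subtype.ext h'
  | cyclic i =>
    simp only [map_sum, map_mul, map_zero, FreeAlgebra.lift_ι_apply] at h' ⊢
    simp only [gen_mul]
    rw [← map_sum, ← (DirectSum.of (fun n => degree K k d I n)
      ((k * d - 1) + (k * d - 1))).map_zero]
    congr 1
    refine Subtype.ext ?_
    rw [AddSubmonoidClass.coe_finsetSum]
    exact h'

/-- The decomposition of an element into homogeneous components. -/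
def decomposeHom : OSAlgebra K k d I →ₐ[K] ⨁ n, degree K k d I n :=
  RingQuot.liftAlgHom K ⟨FreeAlgebra.lift K (gen K k d I), fun _ _ h => gen_rel K k d I h⟩

theorem decomposeHom_ω (s : Fin (k + 1) ↪ I) : decomposeHom K k d I (ω K k d s) = gen K k d I s :=
  (RingQuot.liftAlgHom_mkAlgHom_apply _ _ _ _).trans (FreeAlgebra.lift_ι_apply _ _)

theorem decomposeHom_prod (l : List (Fin (k + 1) ↪ I)) (n : ℤ)
    (hn : (l.length : ℤ) * (k * d - 1) = n)
    (h : (l.map (ω K k d)).prod ∈ degree K k d I n) :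
    decomposeHom K k d I (l.map (ω K k d)).prod =
      DirectSum.of (fun n => degree K k d I n) n ⟨(l.map (ω K k d)).prod, h⟩ := by
  induction l generalizing n with
  | nil =>
    have h0 : n = 0 := by simpa using hn.symm
    subst h0
    simp only [List.map_nil, List.prod_nil, map_one]
    rfl
  | cons s l ih =>
    have hl : (l.map (ω K k d)).prod ∈ degree K k d I ((l.length : ℤ) * (k * d - 1)) :=
      Submodule.subset_span ⟨l, rfl, rfl⟩
    simp only [List.map_cons, List.prod_cons, map_mul, decomposeHom_ω, ih _ rfl hl]
    rw [gen, DirectSum.of_mul_of]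
    refine DirectSum.of_eq_of_gradedMonoid_eq (Sigma.subtype_ext ?_ rfl)
    simp only [List.length_cons, Nat.cast_add, Nat.cast_one] at hn
    change (k * d - 1 : ℤ) + (l.length : ℤ) * (k * d - 1) = n
    linarith

/-- The grading of the generalized Orlik-Solomon algebra, `ω_S` having degree `kd - 1`. -/
instance : GradedAlgebra (degree K k d I) :=
  GradedAlgebra.ofAlgHom _ (decomposeHom K k d I)
    (by
      refine RingQuot.ringQuot_ext' _ _ _ (FreeAlgebra.hom_ext (funext fun s => ?_))
      change DirectSum.coeAlgHom _ (decomposeHom K k d I (ω K k d s)) = ω K k d s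
      rw [decomposeHom_ω, gen, DirectSum.coeAlgHom_of])
    (by
      rintro n ⟨x, hx⟩
      dsimp only
      induction hx using Submodule.span_induction with
      | mem x h =>
        obtain ⟨l, hl, rfl⟩ := h
        exact decomposeHom_prod K k d I l n hl _
      | zero => rw [map_zero]; exact (map_zero _).symm
      | add x y hx hy ihx ihy => rw [map_add, ihx, ihy, ← map_add]; rfl
      | smul c x hx ih =>
        rw [map_smul, ih, ← DirectSum.lof_eq_of K, ← DirectSum.lof_eq_of K, ← map_smul]; rfl)

/-- The four-case rule for the values of `φ^{I,J}` on the generators. -/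
structure CocompositionRule (J : Type u)
    (φ : OSAlgebra K k d (I ⊕ J) →ₐ[K]
      GradedTensorProduct K (degree K k d (Option I)) (degree K k d J)) : Prop where
  /-- `ω_S ↦ ω_S ⊗ 1` if `S ⊆ I` -/
  left : ∀ s : Fin (k + 1) ↪ I, φ (ω K k d (s.trans Function.Embedding.inl)) =
    GradedTensorProduct.tmul K (ω K k d (s.trans Function.Embedding.some)) 1
  /-- `ω_S ↦ 1 ⊗ ω_S` if `S ⊆ J` -/
  right : ∀ s : Fin (k + 1) ↪ J, φ (ω K k d (s.trans Function.Embedding.inr)) =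
    GradedTensorProduct.tmul K 1 (ω K k d s)
  /-- `ω_S ↦ ω_{S \ {s} ⊔ {*}} ⊗ 1` if `S ∩ J = {s}`, where `*` takes the position of `s` -/
  single : ∀ (s : Fin (k + 1) ↪ I ⊕ J) (t : Fin (k + 1) ↪ Option I) (a : Fin (k + 1)) (j : J),
    s a = Sum.inr j → t a = none → (∀ b, b ≠ a → ∃ i, s b = Sum.inl i ∧ t b = some i) →
    φ (ω K k d s) = GradedTensorProduct.tmul K (ω K k d t) 1
  /-- `ω_S ↦ 0` if `|S ∩ I| ≥ 1` and `|S ∩ J| ≥ 2` -/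
  zero : ∀ s : Fin (k + 1) ↪ I ⊕ J, 1 ≤ (Set.range s ∩ Set.range Sum.inl).ncard →
    2 ≤ (Set.range s ∩ Set.range Sum.inr).ncard → φ (ω K k d s) = 0

end OSAlgebra
end OrlikSolomon
end

/-! An algebra morphism out of 𝒜^k_d(I) is determined by its values on the generators. Uniqueness
follows once the four cases of the rule are seen to cover every ω_S (`CocompositionRule.eq`); the
counit has no freedom because, for k ≥ 1, a one-point set carries no generator. The content is
existence.

Well-definedness of φ^{I,J}. Contract J to the point *. If ω of a list with repetitions is declared
to be 0 (`ωOf`), the four cases become two: 1 ⊗ ω_S if S lies in J, and ω of the contracted list,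
tensored with 1, otherwise (`cocompVal`). The only delicate relation is the cyclic one, when the
2k+1 points meet I and meet J at least twice. A product of two windows that both meet I then
vanishes (`cocompVal_window_mul_eq_zero`). A window inside J occurs in two products, and its
partners there have contractions that differ by a rotation; the rotation sign (-1)^{kd} and the
Koszul sign (-1)^{(kd-1)^2} are opposite, so the two products cancel
(`cocompVal_window_add_eq_zero`).

Coherence. Each axiom equates two linear maps out of some 𝒜^k_d(I). Both send 1 to the unit, and it
suffices that both turn left multiplication by each ω_S into the same operator on the target
(`linearMap_ext`). Such operators propagate through composites and tensor products
(`LinearMap.Intertwines`), so an axiom reduces to following one list S through both sides. Koszul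
signs enter only through `parity`: left multiplication by ω ⊗ 1 is (ω·) ⊗ id, and by 1 ⊗ ω it is
`parity` ⊗ (ω·). The structure maps commute with `parity`, so the signs on the two sides match. -/

noncomputable section

/-! ### Intertwining of operators along linear maps -/

namespace LinearMap

section Semiring

variable {R : Type*} [CommSemiring R] {M N P M' N' : Type*} [AddCommMonoid M] [AddCommMonoid N]
  [AddCommMonoid P] [AddCommMonoid M'] [AddCommMonoid N'] [Module R M] [Module R N] [Module R P]
  [Module R M'] [Module R N']

/-- The linear map `p` intertwines the endomorphisms `f` and `g`. -/
structure Intertwines (p : M →ₗ[R] N) (f : M →ₗ[R] M) (g : N →ₗ[R] N) : Prop where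
  apply : ∀ x, p (f x) = g (p x)

namespace Intertwines

theorem id_id (p : M →ₗ[R] N) : Intertwines p LinearMap.id LinearMap.id :=
  ⟨fun _ => rfl⟩

theorem refl (f : M →ₗ[R] M) : Intertwines LinearMap.id f f :=
  ⟨fun _ => rfl⟩

theorem trans {p : M →ₗ[R] N} {q : N →ₗ[R] P} {f : M →ₗ[R] M} {g : N →ₗ[R] N} {h : P →ₗ[R] P}
    (hp : Intertwines p f g) (hq : Intertwines q g h) : Intertwines (q ∘ₗ p) f h :=
  ⟨fun x => by rw [comp_apply, hp.apply, hq.apply, comp_apply]⟩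

theorem tensor {p : M →ₗ[R] N} {q : M' →ₗ[R] N'} {f : M →ₗ[R] M} {g : N →ₗ[R] N}
    {f' : M' →ₗ[R] M'} {g' : N' →ₗ[R] N'} (hp : Intertwines p f g) (hq : Intertwines q f' g') :
    Intertwines (TensorProduct.map p q) (TensorProduct.map f f') (TensorProduct.map g g') := by
  refine ⟨fun z => ?_⟩
  induction z with
  | zero => simp
  | add z z' h h' => simp only [map_add, h, h']
  | tmul a b => simp only [TensorProduct.map_tmul, hp.apply, hq.apply]

theorem assoc (f : M →ₗ[R] M) (g : N →ₗ[R] N) (h : P →ₗ[R] P) :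
    Intertwines (TensorProduct.assoc R M N P).toLinearMap
      (TensorProduct.map (TensorProduct.map f g) h)
      (TensorProduct.map f (TensorProduct.map g h)) :=
  ⟨fun z => (TensorProduct.map_map_assoc f g h z).symm⟩

/-- Variant of `assoc` for a generator acting on the outermost left factor only: the identity on the
other two factors must appear as a single `LinearMap.id` for the operators of the two sides of an
axiom to coincide. -/
theorem assoc_left (f : M →ₗ[R] M) :
    Intertwines (TensorProduct.assoc R M N P).toLinearMap
      (TensorProduct.map (TensorProduct.map f LinearMap.id) LinearMap.id)
      (TensorProduct.map f LinearMap.id) := by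
  have h := assoc f (LinearMap.id (R := R) (M := N)) (LinearMap.id (R := R) (M := P))
  rwa [TensorProduct.map_id (R := R) (M := N) (N := P)] at h

theorem lid (f : M →ₗ[R] M) : Intertwines (TensorProduct.lid R M).toLinearMap
    (TensorProduct.map LinearMap.id f) f := by
  refine ⟨fun z => ?_⟩
  induction z with
  | zero => simp
  | add z z' h h' => simp only [map_add, h, h']
  | tmul c x => simp

theorem rid (f : M →ₗ[R] M) : Intertwines (TensorProduct.rid R M).toLinearMap
    (TensorProduct.map f LinearMap.id) f := by
  refine ⟨fun z => ?_⟩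
  induction z with
  | zero => simp
  | add z z' h h' => simp only [map_add, h, h']
  | tmul x c => simp

end Intertwines
end Semiring

section Ring

variable {R : Type*} [CommRing R] {M N : Type*} [AddCommGroup M] [AddCommGroup N] [Module R M]
  [Module R N]

theorem Intertwines.units_smul {p : M →ₗ[R] N} {f : M →ₗ[R] M} {g : N →ₗ[R] N}
    (h : Intertwines p f g) (c : ℤˣ) : Intertwines p (c • f) (c • g) :=
  ⟨fun x => by rw [smul_apply, smul_apply, map_smul_of_tower, h.apply]⟩

theorem tensorProduct_map_units_smul_left (c : ℤˣ) (f : M →ₗ[R] M) (g : N →ₗ[R] N) :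
    TensorProduct.map (c • f) g = c • TensorProduct.map f g := by
  ext x y
  rcases Int.units_eq_one_or c with rfl | rfl <;> simp [Units.neg_smul, TensorProduct.neg_tmul]

theorem tensorProduct_map_units_smul_right (c : ℤˣ) (f : M →ₗ[R] M) (g : N →ₗ[R] N) :
    TensorProduct.map f (c • g) = c • TensorProduct.map f g := by
  ext x y
  rcases Int.units_eq_one_or c with rfl | rfl <;> simp [Units.neg_smul, TensorProduct.tmul_neg]

end Ring
end LinearMap

/-! ### Generators, relations and the universal property of 𝒜^k_d(I) -/

namespace OSAlgebra

variable (K : Type v) [Field K] (k : ℕ) (d : ℤ) {I J L : Type u}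

theorem span_prod_eq_top :
    Submodule.span K (Set.range fun l : List (Fin (k + 1) ↪ I) => (l.map (ω K k d)).prod) = ⊤ := by
  rw [eq_top_iff, ← (DirectSum.Decomposition.isInternal (degree K k d I)).submodule_iSup_eq_top]
  refine iSup_le fun n => Submodule.span_mono ?_
  rintro _ ⟨l, -, rfl⟩
  exact ⟨l, rfl⟩

variable {K k d} in
/-- Two linear maps on `𝒜^k_d(I)` that agree on `1` and turn the multiplication by each generator
into the same operator are equal. -/
theorem linearMap_ext {X : Type*} [AddCommGroup X] [Module K X] {S T : OSAlgebra K k d I →ₗ[K] X}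
    (h1 : S 1 = T 1)
    (h : ∀ s : Fin (k + 1) ↪ I, ∃ M : X →ₗ[K] X,
      LinearMap.Intertwines S (LinearMap.mulLeft K (ω K k d s)) M ∧
        LinearMap.Intertwines T (LinearMap.mulLeft K (ω K k d s)) M) : S = T := by
  refine LinearMap.ext_on (span_prod_eq_top K k d) ?_
  rintro _ ⟨l, rfl⟩
  induction l with
  | nil => simpa using h1
  | cons s l ih =>
    obtain ⟨M, hS, hT⟩ := h s
    beta_reduce at ih ⊢
    rw [List.map_cons, List.prod_cons, ← LinearMap.mulLeft_apply K, hS.apply, hT.apply]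
    exact congrArg M ih

/-- The universal property of `𝒜^k_d(I)`. -/
def lift {C : Type*} [Ring C] [Algebra K C] (v : (Fin (k + 1) ↪ I) → C)
    (hv : ∀ ⦃x y⦄, OSRel K k d I x y → FreeAlgebra.lift K v x = FreeAlgebra.lift K v y) :
    OSAlgebra K k d I →ₐ[K] C :=
  RingQuot.liftAlgHom K ⟨FreeAlgebra.lift K v, hv⟩

theorem lift_ω {C : Type*} [Ring C] [Algebra K C] (v : (Fin (k + 1) ↪ I) → C)
    (hv : ∀ ⦃x y⦄, OSRel K k d I x y → FreeAlgebra.lift K v x = FreeAlgebra.lift K v y)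
    (s : Fin (k + 1) ↪ I) : lift K k d v hv (ω K k d s) = v s :=
  (RingQuot.liftAlgHom_mkAlgHom_apply _ _ _ _).trans (FreeAlgebra.lift_ι_apply _ _)

variable {K k d} in
theorem algHom_ext {C : Type*} [Ring C] [Algebra K C] {f g : OSAlgebra K k d I →ₐ[K] C}
    (h : ∀ s, f (ω K k d s) = g (ω K k d s)) : f = g :=
  RingQuot.ringQuot_ext' _ _ _ (FreeAlgebra.hom_ext (funext h))

theorem lift_rel {C : Type*} [Ring C] [Algebra K C] (v : (Fin (k + 1) ↪ I) → C)
    (symm : ∀ (σ : Equiv.Perm (Fin (k + 1))) (s : Fin (k + 1) ↪ I),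
      v (σ.toEmbedding.trans s) = (Equiv.Perm.sign σ ^ d) • v s)
    (comm : ∀ s t, v s * v t = ((-1 : ℤˣ) ^ ((k * d - 1) * (k * d - 1) : ℤ)) • (v t * v s))
    (mul_zero : ∀ s t : Fin (k + 1) ↪ I, 1 < (Set.range s ∩ Set.range t).ncard → v s * v t = 0)
    (cyclic : ∀ i : ZMod (2 * k + 1) ↪ I,
      ∑ m, v (cyclicWindow i m) * v (cyclicWindow i (m + (k : ZMod (2 * k + 1)))) = 0)
    ⦃x y : FreeAlgebra K (Fin (k + 1) ↪ I)⦄ (h : OSRel K k d I x y) :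
    FreeAlgebra.lift K v x = FreeAlgebra.lift K v y := by
  cases h with
  | symm σ s => simpa [AlgHom.map_smul_of_tower] using symm σ s
  | comm s t => simpa [AlgHom.map_smul_of_tower] using comm s t
  | mul_zero s t h => simpa using mul_zero s t h
  | cyclic i => simpa using cyclic i

theorem ω_perm (σ : Equiv.Perm (Fin (k + 1))) (s : Fin (k + 1) ↪ I) :
    ω K k d (σ.toEmbedding.trans s) = (Equiv.Perm.sign σ ^ d) • ω K k d s := by
  have h := mk_rel K k d I (OSRel.symm σ s)
  rwa [AlgHom.map_smul_of_tower] at h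

theorem ω_mul_comm (s t : Fin (k + 1) ↪ I) : ω K k d s * ω K k d t =
    ((-1 : ℤˣ) ^ ((k * d - 1) * (k * d - 1) : ℤ)) • (ω K k d t * ω K k d s) := by
  have h := mk_rel K k d I (OSRel.comm s t)
  rwa [AlgHom.map_smul_of_tower, map_mul, map_mul] at h

theorem ω_mul_eq_zero (s t : Fin (k + 1) ↪ I) (h : 1 < (Set.range s ∩ Set.range t).ncard) :
    ω K k d s * ω K k d t = 0 := by
  have h := mk_rel K k d I (OSRel.mul_zero s t h)
  rwa [map_mul, map_zero] at h

theorem ω_cyclic (i : ZMod (2 * k + 1) ↪ I) :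
    ∑ m, ω K k d (cyclicWindow i m) * ω K k d (cyclicWindow i (m + (k : ZMod (2 * k + 1)))) =
      0 := by
  have h := mk_rel K k d I (OSRel.cyclic i)
  rwa [map_sum, map_zero, Finset.sum_congr rfl fun m _ => map_mul (mk K k d I) _ _] at h

/-! ### Relabelling, augmentation, parity -/

/-- The morphism `𝒜^k_d(I) → 𝒜^k_d(J)` induced by an injection. -/
def map (e : I ↪ J) : OSAlgebra K k d I →ₐ[K] OSAlgebra K k d J :=
  lift K k d (fun s => ω K k d (s.trans e)) <| lift_rel K k d _
    (fun σ s => ω_perm K k d σ (s.trans e))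
    (fun s t => ω_mul_comm K k d _ _)
    (fun s t h => ω_mul_eq_zero K k d _ _ <| by
      have hr : ∀ s : Fin (k + 1) ↪ I, Set.range (s.trans e) = e '' Set.range s := fun s => by
        rw [← Set.range_comp]; rfl
      rwa [hr, hr, ← Set.image_inter e.injective, Set.ncard_image_of_injective _ e.injective])
    (fun i => ω_cyclic K k d (i.trans e))

@[simp]
theorem map_ω (e : I ↪ J) (s : Fin (k + 1) ↪ I) :
    map K k d e (ω K k d s) = ω K k d (s.trans e) :=
  lift_ω K k d _ _ s

/-- The augmentation, killing all the generators. -/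
def augmentation : OSAlgebra K k d I →ₐ[K] K :=
  lift K k d (fun _ => 0) <| lift_rel K k d _ (by simp) (by simp) (by simp) (by simp)

@[simp]
theorem augmentation_ω (s : Fin (k + 1) ↪ I) : augmentation K k d (ω K k d s) = 0 :=
  lift_ω K k d _ _ s

/-- The automorphism multiplying an element of degree `m` by `(-1) ^ ((k * d - 1) * m)`. -/
def parity : OSAlgebra K k d I →ₐ[K] OSAlgebra K k d I :=
  lift K k d (fun s => ((-1 : ℤˣ) ^ ((k * d - 1) * (k * d - 1) : ℤ)) • ω K k d s) <| by
    have h : ∀ s t : Fin (k + 1) ↪ I,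
        (((-1 : ℤˣ) ^ ((k * d - 1) * (k * d - 1) : ℤ)) • ω K k d s) *
          (((-1 : ℤˣ) ^ ((k * d - 1) * (k * d - 1) : ℤ)) • ω K k d t) = ω K k d s * ω K k d t := by
      intro s t
      rcases Int.units_eq_one_or ((-1 : ℤˣ) ^ ((k * d - 1) * (k * d - 1) : ℤ)) with hc | hc <;>
        simp [hc, Units.neg_smul]
    refine lift_rel K k d _ ?_ ?_ ?_ ?_
    · intro σ s
      rw [ω_perm, smul_comm]
    · intro s t
      rw [h, h, ω_mul_comm]
    · intro s t hst
      rw [h, ω_mul_eq_zero K k d s t hst]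
    · intro i
      simp only [h, ω_cyclic]

@[simp]
theorem parity_ω (s : Fin (k + 1) ↪ I) : parity K k d (ω K k d s) =
    ((-1 : ℤˣ) ^ ((k * d - 1) * (k * d - 1) : ℤ)) • ω K k d s :=
  lift_ω K k d _ _ s

theorem parity_of_mem {m : ℤ} {a : OSAlgebra K k d I} (ha : a ∈ degree K k d I m) :
    parity K k d a = ((-1 : ℤˣ) ^ ((k * d - 1) * m : ℤ)) • a := by
  induction ha using Submodule.span_induction with
  | mem x h =>
    obtain ⟨l, rfl, rfl⟩ := h
    induction l with
    | nil => simp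
    | cons s l ih =>
      simp only [List.map_cons, List.prod_cons, map_mul, ih, parity_ω, List.length_cons,
        smul_mul_smul_comm, ← zpow_add]
      congr 2
      push_cast
      ring
  | zero => simp
  | add x y _ _ hx hy => rw [map_add, hx, hy, smul_add]
  | smul c x _ hx => rw [map_smul, hx, smul_comm]

theorem units_smul_mem (c : ℤˣ) {m : ℤ} {a : OSAlgebra K k d I} (ha : a ∈ degree K k d I m) :
    c • a ∈ degree K k d I m := by
  rcases Int.units_eq_one_or c with rfl | rfl
  · simpa using ha
  · simpa [Units.neg_smul] using ha

theorem parity_mem {m : ℤ} {a : OSAlgebra K k d I} (ha : a ∈ degree K k d I m) :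
    parity K k d a ∈ degree K k d I m := by
  rw [parity_of_mem K k d ha]
  exact units_smul_mem K k d _ ha

/-- Relabelling preserves degrees, and `parity` depends only on the degree. This carries the sign
operator left behind by a generator in the right tensor factor through a relabelling of the left
factor. -/
theorem intertwines_map_parity (e : I ↪ J) : LinearMap.Intertwines (map K k d e).toLinearMap
    (parity K k d).toLinearMap (parity K k d).toLinearMap := by
  have h : (map K k d e).comp (parity K k d) = (parity K k d).comp (map K k d e) :=
    algHom_ext fun s => by simp
  exact ⟨DFunLike.congr_fun h⟩

theorem intertwines_augmentation_parity :
    LinearMap.Intertwines (augmentation K k d (I := I)).toLinearMap (parity K k d).toLinearMap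
      LinearMap.id := by
  have h : (augmentation K k d (I := I)).comp (parity K k d) = augmentation K k d :=
    algHom_ext fun s => by simp
  exact ⟨DFunLike.congr_fun h⟩

theorem map_mem (e : I ↪ J) {m : ℤ} {a : OSAlgebra K k d I} (ha : a ∈ degree K k d I m) :
    map K k d e a ∈ degree K k d J m := by
  induction ha using Submodule.span_induction with
  | mem x h =>
    obtain ⟨l, rfl, rfl⟩ := h
    refine Submodule.subset_span ⟨l.map (·.trans e), by simp, ?_⟩
    simp [map_list_prod, Function.comp_def]
  | zero => simp
  | add x y _ _ hx hy => rw [map_add]; exact add_mem hx hy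
  | smul c x _ hx => rw [map_smul]; exact Submodule.smul_mem _ c hx

theorem augmentation_of_mem {m : ℤ} (hm : m ≠ 0) {a : OSAlgebra K k d I}
    (ha : a ∈ degree K k d I m) : augmentation K k d a = 0 := by
  induction ha using Submodule.span_induction with
  | mem x h =>
    obtain ⟨l, rfl, rfl⟩ := h
    cases l with
    | nil => simp at hm
    | cons s l => simp
  | zero => simp
  | add x y _ _ hx hy => rw [map_add, hx, hy, add_zero]
  | smul c x _ hx => rw [map_smul, hx, smul_zero]

/-- Move ω_S past the factors of a monomial one at a time. General graded commutativity follows by a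
second induction, on the other factor. -/
theorem ω_mul_of_mem (s : Fin (k + 1) ↪ I) {m : ℤ} {a : OSAlgebra K k d I}
    (ha : a ∈ degree K k d I m) :
    ω K k d s * a = ((-1 : ℤˣ) ^ ((k * d - 1) * m : ℤ)) • (a * ω K k d s) := by
  induction ha using Submodule.span_induction with
  | mem x h =>
    obtain ⟨l, rfl, rfl⟩ := h
    induction l with
    | nil => simp
    | cons t l ih =>
      simp only [List.map_cons, List.prod_cons]
      rw [← mul_assoc, ω_mul_comm, smul_mul_assoc, mul_assoc, ih, mul_smul_comm, smul_smul,
        ← zpow_add, mul_assoc]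
      congr 2
      simp only [List.length_cons]
      push_cast
      ring
  | zero => simp
  | add x y _ _ hx hy => rw [mul_add, hx, hy, add_mul, smul_add]
  | smul c x _ hx => rw [mul_smul_comm, hx, smul_mul_assoc, smul_comm]

theorem mul_comm_of_mem {i j : ℤ} {a b : OSAlgebra K k d I} (ha : a ∈ degree K k d I i)
    (hb : b ∈ degree K k d I j) : a * b = ((-1 : ℤˣ) ^ (i * j)) • (b * a) := by
  induction ha using Submodule.span_induction with
  | mem x h =>
    obtain ⟨l, rfl, rfl⟩ := h
    induction l with
    | nil => simp
    | cons t l ih =>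
      simp only [List.map_cons, List.prod_cons]
      rw [mul_assoc, ih, mul_smul_comm, ← mul_assoc, ω_mul_of_mem K k d t hb, smul_mul_assoc,
        smul_smul, ← zpow_add, mul_assoc, mul_assoc]
      congr 2
      simp only [List.length_cons]
      push_cast
      ring
  | zero => simp
  | add x y _ _ hx hy => rw [add_mul, hx, hy, mul_add, smul_add]
  | smul c x _ hx => rw [mul_smul_comm, smul_mul_assoc, hx, smul_comm]

/-! ### Generators indexed by arbitrary functions -/

open Classical in
/-- `ω_S` if `f` lists the elements of `S`, and `0` if `f` has repetitions. -/
def ωOf (f : Fin (k + 1) → I) : OSAlgebra K k d I :=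
  if h : Function.Injective f then ω K k d ⟨f, h⟩ else 0

theorem ωOf_coe (s : Fin (k + 1) ↪ I) : ωOf K k d s = ω K k d s :=
  dif_pos s.injective

variable {k} in
theorem ωOf_of_not_injective {f : Fin (k + 1) → I} (h : ¬ Function.Injective f) :
    ωOf K k d f = 0 :=
  dif_neg h

theorem ωOf_mem (f : Fin (k + 1) → I) : ωOf K k d f ∈ degree K k d I (k * d - 1) := by
  by_cases h : Function.Injective f
  · lift f to Fin (k + 1) ↪ I using h
    rw [ωOf_coe]
    exact ω_mem K k d I f
  · rw [ωOf_of_not_injective K d h]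
    exact zero_mem _

theorem ωOf_perm (σ : Equiv.Perm (Fin (k + 1))) (f : Fin (k + 1) → I) :
    ωOf K k d (f ∘ σ) = (Equiv.Perm.sign σ ^ d) • ωOf K k d f := by
  by_cases h : Function.Injective f
  · lift f to Fin (k + 1) ↪ I using h
    rw [ωOf_coe, ← ω_perm, ← ωOf_coe]
    rfl
  · rw [ωOf_of_not_injective K d h, ωOf_of_not_injective K d (by simpa using h), smul_zero]

variable {k} in
-- Exhibiting two common values, rather than a cardinality, makes the relation usable for contracted
-- lists, which may have repetitions; in that case a factor is already 0.
theorem ωOf_mul_eq_zero {f g : Fin (k + 1) → I} {x y : I} (hxy : x ≠ y)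
    (hx : x ∈ Set.range f ∩ Set.range g) (hy : y ∈ Set.range f ∩ Set.range g) :
    ωOf K k d f * ωOf K k d g = 0 := by
  by_cases hf : Function.Injective f
  · by_cases hg : Function.Injective g
    · lift f to Fin (k + 1) ↪ I using hf
      lift g to Fin (k + 1) ↪ I using hg
      rw [ωOf_coe, ωOf_coe]
      refine ω_mul_eq_zero K k d f g ?_
      rw [Set.one_lt_ncard_iff ((Set.finite_range f).inter_of_left _)]
      exact ⟨x, y, hx, hy, hxy⟩
    · rw [ωOf_of_not_injective K d hg, mul_zero]
  · rw [ωOf_of_not_injective K d hf, zero_mul]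

theorem ωOf_cyclic {i : ZMod (2 * k + 1) → I} (hi : Function.Injective i) :
    ∑ m : ZMod (2 * k + 1), ωOf K k d (fun j => i (m + ((j : ℕ) : ZMod (2 * k + 1)))) *
      ωOf K k d (fun j => i (m + (k : ZMod (2 * k + 1)) + ((j : ℕ) : ZMod (2 * k + 1)))) = 0 := by
  rw [← ω_cyclic K k d ⟨i, hi⟩]
  simp only [← ωOf_coe]
  rfl

theorem map_ωOf (e : I ↪ J) (f : Fin (k + 1) → I) :
    map K k d e (ωOf K k d f) = ωOf K k d (e ∘ f) := by
  by_cases h : Function.Injective f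
  · lift f to Fin (k + 1) ↪ I using h
    rw [ωOf_coe, map_ω, ← ωOf_coe]
    rfl
  · rw [ωOf_of_not_injective K d h, ωOf_of_not_injective K d fun h' => h h'.of_comp, map_zero]

variable {k} in
theorem intertwines_map_ωOf {e : I ↪ J} {f : Fin (k + 1) → I} {g : Fin (k + 1) → J}
    (h : ∀ a, e (f a) = g a) : LinearMap.Intertwines (map K k d e).toLinearMap
      (LinearMap.mulLeft K (ωOf K k d f)) (LinearMap.mulLeft K (ωOf K k d g)) := by
  refine ⟨fun x => ?_⟩
  rw [LinearMap.mulLeft_apply, AlgHom.toLinearMap_apply, map_mul, map_ωOf, (funext h : ⇑e ∘ f = g)]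
  rfl

theorem intertwines_parity_ωOf (f : Fin (k + 1) → I) :
    LinearMap.Intertwines (parity K k d).toLinearMap (LinearMap.mulLeft K (ωOf K k d f))
      (((-1 : ℤˣ) ^ ((k * d - 1) * (k * d - 1) : ℤ)) • LinearMap.mulLeft K (ωOf K k d f)) := by
  refine ⟨fun x => ?_⟩
  rw [LinearMap.mulLeft_apply, AlgHom.toLinearMap_apply, map_mul,
    parity_of_mem K k d (ωOf_mem K k d f), smul_mul_assoc]
  rfl

end OSAlgebra

/-! ### Signs in the graded tensor product -/

namespace GradedTensorProduct

variable {K : Type v} {A B : Type w} [Field K] [Ring A] [Algebra K A] [Ring B]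
    [Algebra K B] (𝒜 : ℤ → Submodule K A) (ℬ : ℤ → Submodule K B) [GradedAlgebra 𝒜]
    [GradedAlgebra ℬ]

theorem tmul_one_mul_tmul_one (a a' : A) :
    (tmul K a 1 : GradedTensorProduct K 𝒜 ℬ) * tmul K a' 1 = tmul K (a * a') 1 :=
  ((includeLeft 𝒜 ℬ).map_mul a a').symm

theorem one_tmul_mul_one_tmul (b b' : B) :
    (tmul K 1 b : GradedTensorProduct K 𝒜 ℬ) * tmul K 1 b' = tmul K 1 (b * b') :=
  ((includeRight 𝒜 ℬ).map_mul b b').symm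

theorem one_tmul_mul_tmul_one {i j : ℤ} {a : A} {b : B} (ha : a ∈ 𝒜 i) (hb : b ∈ ℬ j) :
    (tmul K 1 b : GradedTensorProduct K 𝒜 ℬ) * tmul K a 1 =
      ((-1 : ℤˣ) ^ (j * i)) • tmul K a b := by
  have h := tmul_coe_mul_coe_tmul 𝒜 ℬ (1 : A) ⟨b, hb⟩ ⟨a, ha⟩ (1 : B)
  rwa [one_mul, mul_one] at h

theorem tmul_zero_left (b : B) : (tmul K 0 b : GradedTensorProduct K 𝒜 ℬ) = 0 := by
  rw [tmul, TensorProduct.zero_tmul, map_zero]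

theorem tmul_zero_right (a : A) : (tmul K a 0 : GradedTensorProduct K 𝒜 ℬ) = 0 := by
  rw [tmul, TensorProduct.tmul_zero, map_zero]

theorem tmul_units_smul_left (c : ℤˣ) (a : A) (b : B) :
    (tmul K (c • a) b : GradedTensorProduct K 𝒜 ℬ) = c • tmul K a b := by
  rcases Int.units_eq_one_or c with rfl | rfl
  · simp
  · simp [Units.neg_smul, tmul, TensorProduct.neg_tmul]

theorem tmul_units_smul_right (c : ℤˣ) (a : A) (b : B) :
    (tmul K a (c • b) : GradedTensorProduct K 𝒜 ℬ) = c • tmul K a b := by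
  rcases Int.units_eq_one_or c with rfl | rfl
  · simp
  · simp [Units.neg_smul, tmul, TensorProduct.tmul_neg]

end GradedTensorProduct

/-! ### The cocomposition on generators and the relations of low complexity -/

namespace OSAlgebra

open GradedTensorProduct

variable (K : Type v) [Field K] (k : ℕ) (d : ℤ) {I J L : Type u}

/-- The map `I ⊔ J → I ⊔ {*}` contracting `J` to a point. -/
def contract : I ⊕ J → Option I := Sum.elim some fun _ => none

theorem contract_eq_none {x : I ⊕ J} : contract x = none ↔ ∃ j, x = Sum.inr j := by
  cases x <;> simp [contract]

theorem contract_ne_none {x : I ⊕ J} : contract x ≠ none ↔ ∃ i, x = Sum.inl i := by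
  cases x <;> simp [contract]

theorem exists_eq_inr_comp {ι : Type*} (f : ι → I ⊕ J) :
    (∃ g, f = Sum.inr ∘ g) ∨ ∃ a i, f a = Sum.inl i := by
  by_cases h : ∃ a i, f a = Sum.inl i
  · exact Or.inr h
  · have h' : ∀ a, ∃ j, f a = Sum.inr j := fun a => by
      rcases hf : f a with i | j
      · exact (h ⟨a, i, hf⟩).elim
      · exact ⟨j, rfl⟩
    choose g hg using h'
    exact Or.inl ⟨g, funext hg⟩

open Classical in
/-- The value of the partial cocomposition on the generator given by `f`. -/
def cocompVal (f : Fin (k + 1) → I ⊕ J) :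
    GradedTensorProduct K (degree K k d (Option I)) (degree K k d J) :=
  -- The lift g is unique since `Sum.inr` is injective. The other branch covers three cases of the
  -- rule at once: if f has two entries in J, its contraction repeats * and `ωOf` returns 0.
  if h : ∃ g : Fin (k + 1) → J, f = Sum.inr ∘ g then tmul K 1 (ωOf K k d h.choose)
  else tmul K (ωOf K k d (contract ∘ f)) 1

theorem cocompVal_inr (g : Fin (k + 1) → J) :
    cocompVal K k d (I := I) (Sum.inr ∘ g) = tmul K 1 (ωOf K k d g) := by
  have h : ∃ g' : Fin (k + 1) → J, (Sum.inr ∘ g : Fin (k + 1) → I ⊕ J) = Sum.inr ∘ g' := ⟨g, rfl⟩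
  rw [cocompVal, dif_pos h, ← Sum.inr_injective.comp_left h.choose_spec]

variable {k} in
theorem cocompVal_of_inl {f : Fin (k + 1) → I ⊕ J} (h : ∃ a i, f a = Sum.inl i) :
    cocompVal K k d f = tmul K (ωOf K k d (contract ∘ f)) 1 := by
  refine dif_neg ?_
  rintro ⟨g, rfl⟩
  obtain ⟨a, i, h⟩ := h
  cases h

theorem cocompVal_perm (σ : Equiv.Perm (Fin (k + 1))) (f : Fin (k + 1) → I ⊕ J) :
    cocompVal K k d (f ∘ σ) = (Equiv.Perm.sign σ ^ d) • cocompVal K k d f := by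
  rcases exists_eq_inr_comp f with ⟨g, rfl⟩ | ⟨a, i, h⟩
  · rw [Function.comp_assoc, cocompVal_inr, cocompVal_inr, ωOf_perm, tmul_units_smul_right]
  · rw [cocompVal_of_inl K d ⟨a, i, h⟩, cocompVal_of_inl K d ⟨σ⁻¹ a, i, by simpa using h⟩,
      ← Function.comp_assoc, ωOf_perm, tmul_units_smul_left]

theorem ωOf_mul_comm (f g : Fin (k + 1) → I) : ωOf K k d f * ωOf K k d g =
    ((-1 : ℤˣ) ^ ((k * d - 1) * (k * d - 1) : ℤ)) • (ωOf K k d g * ωOf K k d f) :=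
  mul_comm_of_mem K k d (ωOf_mem K k d f) (ωOf_mem K k d g)

theorem cocompVal_mul_comm (f g : Fin (k + 1) → I ⊕ J) :
    cocompVal K k d f * cocompVal K k d g =
      ((-1 : ℤˣ) ^ ((k * d - 1) * (k * d - 1) : ℤ)) • (cocompVal K k d g * cocompVal K k d f) := by
  rcases exists_eq_inr_comp f with ⟨f, rfl⟩ | hf <;>
    rcases exists_eq_inr_comp g with ⟨g, rfl⟩ | hg
  · rw [cocompVal_inr, cocompVal_inr, one_tmul_mul_one_tmul, one_tmul_mul_one_tmul, ωOf_mul_comm,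
      tmul_units_smul_right]
  · rw [cocompVal_inr, cocompVal_of_inl K d hg,
      one_tmul_mul_tmul_one _ _ (ωOf_mem K k d _) (ωOf_mem K k d _), tmul_one_mul_one_tmul]
  · rw [cocompVal_inr, cocompVal_of_inl K d hf,
      one_tmul_mul_tmul_one _ _ (ωOf_mem K k d _) (ωOf_mem K k d _), tmul_one_mul_one_tmul,
      smul_smul, Int.units_mul_self, one_smul]
  · rw [cocompVal_of_inl K d hf, cocompVal_of_inl K d hg, tmul_one_mul_tmul_one,
      tmul_one_mul_tmul_one, ωOf_mul_comm, tmul_units_smul_left]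

variable {k} in
-- If x and y have the same contraction, they both lie in J: either both lists lie in J and the
-- relation of 𝒜(J) applies, or a list meeting I contracts x and y to a repeated * and its value is
-- 0. If their contractions differ, neither list lies in J and the contracted lists still share two
-- points.
theorem cocompVal_mul_eq_zero {f g : Fin (k + 1) → I ⊕ J} {x y : I ⊕ J} (hxy : x ≠ y)
    (hx : x ∈ Set.range f ∩ Set.range g) (hy : y ∈ Set.range f ∩ Set.range g) :
    cocompVal K k d f * cocompVal K k d g = 0 := by
  by_cases hc : contract x = contract y
  · obtain ⟨⟨a, ha⟩, b, hb⟩ := hx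
    obtain ⟨⟨a', ha'⟩, b', hb'⟩ := hy
    rcases exists_eq_inr_comp f with ⟨f, rfl⟩ | hf
    · rcases exists_eq_inr_comp g with ⟨g, rfl⟩ | hg
      · have hx' : f a = g b := Sum.inr_injective (ha.trans hb.symm)
        have hy' : f a' = g b' := Sum.inr_injective (ha'.trans hb'.symm)
        rw [cocompVal_inr, cocompVal_inr, one_tmul_mul_one_tmul,
          ωOf_mul_eq_zero K d (x := f a) (y := f a') _ ⟨⟨a, rfl⟩, b, hx'.symm⟩
            ⟨⟨a', rfl⟩, b', hy'.symm⟩, tmul_zero_right]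
        intro h
        exact hxy (ha.symm.trans ((congrArg Sum.inr h).trans ha'))
      · rw [cocompVal_of_inl K d hg, ωOf_of_not_injective K d (f := contract ∘ g), tmul_zero_left,
          mul_zero]
        intro h
        have : b = b' := h (by simp only [Function.comp_apply, hb, hb', hc])
        exact hxy (hb.symm.trans (this ▸ hb'))
    · rw [cocompVal_of_inl K d hf, ωOf_of_not_injective K d (f := contract ∘ f), tmul_zero_left,
          zero_mul]
      intro h
      have : a = a' := h (by simp only [Function.comp_apply, ha, ha', hc])
      exact hxy (ha.symm.trans (this ▸ ha'))
  · have hfg : ∀ h : Fin (k + 1) → I ⊕ J, x ∈ Set.range h → y ∈ Set.range h →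
        ∃ a i, h a = Sum.inl i := by
      rintro h ⟨a, rfl⟩ ⟨b, rfl⟩
      by_contra! h'
      rcases exists_eq_inr_comp h with ⟨g, rfl⟩ | ⟨a, i, hi⟩
      · exact hc rfl
      · exact h' a i hi
    have himg : ∀ {z : I ⊕ J} {h : Fin (k + 1) → I ⊕ J}, z ∈ Set.range h →
        contract z ∈ Set.range (contract ∘ h) := by
      rintro _ h ⟨a, rfl⟩
      exact ⟨a, rfl⟩
    rw [cocompVal_of_inl K d (hfg f hx.1 hy.1), cocompVal_of_inl K d (hfg g hx.2 hy.2),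
      tmul_one_mul_tmul_one, ωOf_mul_eq_zero K d hc ⟨himg hx.1, himg hx.2⟩ ⟨himg hy.1, himg hy.2⟩,
      tmul_zero_left]

/-! ### The cyclic relation -/

/-- The window of length `k + 1` starting at position `m` of the cyclic list `i`. -/
def window {k : ℕ} {X : Type*} (i : ZMod (2 * k + 1) → X) (m : ZMod (2 * k + 1))
    (j : Fin (k + 1)) : X :=
  i (m + ((j : ℕ) : ZMod (2 * k + 1)))

variable {k}

/-- The windows at m and m + k overlap in position m + k and together cover all 2k+1 positions. -/
theorem exists_add_natCast_eq (m x : ZMod (2 * k + 1)) :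
    (∃ j : Fin (k + 1), x = m + ((j : ℕ) : ZMod (2 * k + 1))) ∨
      ∃ j : Fin (k + 1), x = m + (k : ZMod (2 * k + 1)) + ((j : ℕ) : ZMod (2 * k + 1)) := by
  have hx : x = m + ((x - m).val : ZMod (2 * k + 1)) := by
    rw [ZMod.natCast_zmod_val]; ring
  have hlt := (x - m).val_lt
  by_cases h : (x - m).val < k + 1
  · exact Or.inl ⟨⟨_, h⟩, hx⟩
  · refine Or.inr ⟨⟨(x - m).val - k, by omega⟩, ?_⟩
    rw [add_assoc, ← Nat.cast_add, Nat.add_sub_cancel' (by omega)]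
    exact hx

theorem natCast_two_mul_add_one_eq_zero : (2 * (k : ZMod (2 * k + 1)) + 1) = 0 := by
  have := ZMod.natCast_self (2 * k + 1)
  push_cast at this
  exact this

/-- If `i` meets `J` twice, then a product of consecutive windows not contained in `J` is killed by
the partial cocomposition. -/
theorem cocompVal_window_mul_eq_zero {i : ZMod (2 * k + 1) → I ⊕ J}
    (hc : ¬ Function.Injective (contract ∘ i)) (hi : Function.Injective i)
    {m : ZMod (2 * k + 1)} (h1 : ∃ a x, window i m a = Sum.inl x)
    (h2 : ∃ a x, window i (m + k) a = Sum.inl x) :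
    cocompVal K k d (window i m) * cocompVal K k d (window i (m + k)) = 0 := by
  rw [cocompVal_of_inl K d h1, cocompVal_of_inl K d h2, tmul_one_mul_tmul_one]
  obtain ⟨p, q, hpq, hne⟩ : ∃ p q, contract (i p) = contract (i q) ∧ p ≠ q := by
    simpa [Function.Injective] using hc
  -- Contraction identifies distinct points only when both are in J.
  have hnone : contract (i p) = none ∧ contract (i q) = none := by
    rcases hp : i p with x | x <;> rcases hq : i q with y | y <;> rw [hp, hq] at hpq
    · simp only [contract, Sum.elim_inl, Option.some.injEq] at hpq
      exact (hne (hi (hp.trans (hpq ▸ hq.symm)))).elim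
    · simp [contract] at hpq
    · simp [contract] at hpq
    · exact ⟨rfl, rfl⟩
  have hzero : ∀ (m p q : ZMod (2 * k + 1)), contract (i p) = none → contract (i q) = none →
      p ≠ q → (∃ j : Fin (k + 1), p = m + ((j : ℕ) : ZMod (2 * k + 1))) →
      (∃ j : Fin (k + 1), q = m + ((j : ℕ) : ZMod (2 * k + 1))) →
      ωOf K k d (contract ∘ window i m) = 0 := by
    rintro m _ _ hp hq hne ⟨a, rfl⟩ ⟨b, rfl⟩
    refine ωOf_of_not_injective K d fun h => hne ?_
    rw [h (hp.trans hq.symm : (contract ∘ window i m) a = (contract ∘ window i m) b)]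
  have hmk1 : ∃ j : Fin (k + 1), m + (k : ZMod (2 * k + 1)) = m + ((j : ℕ) : ZMod (2 * k + 1)) :=
    ⟨Fin.last k, rfl⟩
  have hmk2 : ∃ j : Fin (k + 1), m + (k : ZMod (2 * k + 1)) =
      m + (k : ZMod (2 * k + 1)) + ((j : ℕ) : ZMod (2 * k + 1)) := ⟨0, by simp⟩
  -- Position m + k is common to both windows. If its point is in J, any second point of J repeats *
  -- in whichever window contains it. If not, two points of J in the same window repeat *, while two
  -- in different windows make the contracted windows share both * and the point at m + k.
  by_cases hmk : contract (i (m + k)) = none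
  · obtain ⟨r, hr, hrne⟩ : ∃ r, contract (i r) = none ∧ r ≠ m + k := by
      by_cases h : p = m + k
      · exact ⟨q, hnone.2, fun h' => hne (h.trans h'.symm)⟩
      · exact ⟨p, hnone.1, h⟩
    rcases exists_add_natCast_eq m r with h | h
    · rw [hzero m r (m + k) hr hmk hrne h hmk1, zero_mul, tmul_zero_left]
    · rw [hzero (m + k) r (m + k) hr hmk hrne h hmk2, mul_zero, tmul_zero_left]
  · have hprod : ∀ p q, contract (i p) = none → contract (i q) = none →
        (∃ j : Fin (k + 1), p = m + ((j : ℕ) : ZMod (2 * k + 1))) →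
        (∃ j : Fin (k + 1), q = m + (k : ZMod (2 * k + 1)) + ((j : ℕ) : ZMod (2 * k + 1))) →
        ωOf K k d (contract ∘ window i m) * ωOf K k d (contract ∘ window i (m + k)) = 0 := by
      rintro _ _ hp hq ⟨a, rfl⟩ ⟨b, rfl⟩
      refine ωOf_mul_eq_zero K d (Ne.symm hmk) ⟨⟨a, hp⟩, b, hq⟩ ⟨⟨Fin.last k, rfl⟩, 0, ?_⟩
      simp [window]
    rcases exists_add_natCast_eq m p with h | h <;> rcases exists_add_natCast_eq m q with h' | h'
    · rw [hzero m p q hnone.1 hnone.2 hne h h', zero_mul, tmul_zero_left]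
    · rw [hprod p q hnone.1 hnone.2 h h', tmul_zero_left]
    · rw [hprod q p hnone.2 hnone.1 h' h, tmul_zero_left]
    · rw [hzero _ p q hnone.1 hnone.2 hne h h', mul_zero, tmul_zero_left]

/-- The two terms of the cyclic relation in which a given window is contained in `J` cancel. -/
theorem cocompVal_window_add_eq_zero {i : ZMod (2 * k + 1) → I ⊕ J} {m : ZMod (2 * k + 1)}
    {g : Fin (k + 1) → J} (hg : window i m = Sum.inr ∘ g)
    (h1 : ∃ a x, window i (m + k) a = Sum.inl x) (h2 : ∃ a x, window i (m - k) a = Sum.inl x) :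
    cocompVal K k d (window i m) * cocompVal K k d (window i (m + k)) +
      cocompVal K k d (window i (m - k)) * cocompVal K k d (window i m) = 0 := by
  -- Both partner windows consist of the k positions outside the window at m together with one of
  -- its endpoints, which contracts to *: the last endpoint placed first, or the first endpoint
  -- placed last.
  have hrot : contract ∘ window i (m - k) = (contract ∘ window i (m + k)) ∘ finRotate (k + 1) := by
    funext j
    simp only [Function.comp_apply]
    refine Fin.lastCases ?_ (fun j => ?_) j
    · have e1 : window i (m - k) (Fin.last k) = Sum.inr (g 0) := by
        have := congrFun hg 0
        simpa [window] using this
      have e2 : window i (m + k) 0 = Sum.inr (g (Fin.last k)) := by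
        have := congrFun hg (Fin.last k)
        simpa [window] using this
      rw [finRotate_last, e1, e2]
      rfl
    · rw [finRotate_of_lt (by simp)]
      congr 1
      simp only [window, Fin.val_castSucc]
      congr 1
      push_cast
      -- Modulo 2k+1, m - k = m + k + 1.
      linear_combination -natCast_two_mul_add_one_eq_zero (k := k)
  rw [cocompVal_of_inl K d h1, cocompVal_of_inl K d h2, hrot, hg, cocompVal_inr, ωOf_perm,
    one_tmul_mul_tmul_one _ _ (ωOf_mem K k d _) (ωOf_mem K k d _), tmul_units_smul_left,
    smul_mul_assoc, tmul_one_mul_one_tmul, sign_finRotate]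
  -- Hence (kd-1)^2 has the parity of kd-1, opposite to that of the rotation exponent kd.
  have hev : Even ((k * d - 1) * (k * d - 1 - 1) : ℤ) := Int.even_mul_pred_self _
  have hsign : ((-1 : ℤˣ) ^ k) ^ d = -(-1) ^ ((k * d - 1) * (k * d - 1) : ℤ) := by
    rw [show ((k * d - 1) * (k * d - 1) : ℤ) = (k * d - 1) * (k * d - 1 - 1) + (k * d - 1) by ring,
      zpow_add, hev.neg_one_zpow, one_mul, zpow_sub_one, ← zpow_natCast, ← zpow_mul]
    simp
  rw [Nat.add_sub_cancel, hsign, Units.neg_smul, add_neg_cancel]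

/-- If all points are in J, or if contraction is injective on them, this is the cyclic relation in
one tensor factor. Otherwise the surviving products cancel in pairs. -/
theorem cocompVal_cyclic (hk : 0 < k) {i : ZMod (2 * k + 1) → I ⊕ J} (hi : Function.Injective i) :
    ∑ m, cocompVal K k d (window i m) * cocompVal K k d (window i (m + k)) = 0 := by
  rcases exists_eq_inr_comp i with ⟨g, rfl⟩ | hI
  · have h : ∀ m, window (Sum.inr ∘ g : ZMod (2 * k + 1) → I ⊕ J) m = Sum.inr ∘ window g m :=
      fun m => rfl
    simp only [h, cocompVal_inr, one_tmul_mul_one_tmul]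
    have := congrArg (includeRight (degree K k d (Option I)) (degree K k d J))
      (ωOf_cyclic K k d hi.of_comp)
    rwa [map_sum, map_zero] at this
  by_cases hc : Function.Injective (contract ∘ i)
  · have h : ∀ m, ∃ a x, window i m a = Sum.inl x := by
      intro m
      rcases exists_eq_inr_comp (window i m) with ⟨g, hg⟩ | h
      -- A window has at least two entries because k > 0, so a window inside J would contradict
      -- injectivity of the contraction.
      · have h01 : m + ((0 : ℕ) : ZMod (2 * k + 1)) = m + ((1 : ℕ) : ZMod (2 * k + 1)) := by
          refine hc ?_
          have h0 := congrFun hg 0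
          have h1 := congrFun hg ⟨1, by omega⟩
          simp only [window] at h0 h1
          simp only [Function.comp_apply]
          erw [h0, h1]
          rfl
        have := add_left_cancel h01
        rw [ZMod.natCast_eq_natCast_iff', Nat.mod_eq_of_lt (by omega),
          Nat.mod_eq_of_lt (by omega)] at this
        omega
      · exact h
    simp only [cocompVal_of_inl K d (h _), tmul_one_mul_tmul_one]
    have := congrArg (includeLeft (degree K k d (Option I)) (degree K k d J))
      (ωOf_cyclic K k d hc)
    rwa [map_sum, map_zero] at this
  · classical
    set P : ZMod (2 * k + 1) → Prop := fun m => ∃ g, window i m = Sum.inr ∘ g with hP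
    set t : ZMod (2 * k + 1) → GradedTensorProduct K (degree K k d (Option I)) (degree K k d J) :=
      fun m => cocompVal K k d (window i m) * cocompVal K k d (window i (m + k)) with ht
    have hnot : ∀ m, P m → ∃ a x, window i (m + k) a = Sum.inl x := by
      rintro m ⟨g, hg⟩
      obtain ⟨p, x, hx⟩ := hI
      rcases exists_add_natCast_eq m p with ⟨j, rfl⟩ | ⟨j, rfl⟩
      · have := (congrFun hg j).symm.trans hx
        cases this
      · exact ⟨j, x, hx⟩
    have hnot' : ∀ m, P m → ∃ a x, window i (m - k) a = Sum.inl x := by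
      intro m hm
      rcases exists_eq_inr_comp (window i (m - k)) with hg | h
      · obtain ⟨a, x, h⟩ := hnot _ hg
        obtain ⟨g, hg⟩ := hm
        rw [sub_add_cancel, hg] at h
        cases h
      · exact h
    -- The two conditions exclude each other: the two windows cover all positions, and some point is
    -- in I. Shifting the second sum by k then collects, for each window inside J, its two products.
    have hsplit : ∀ m, t m = (if P m then t m else 0) + if P (m + k) then t m else 0 := by
      intro m
      by_cases h1 : P m
      · rw [if_pos h1, if_neg, add_zero]
        rintro ⟨g, hg⟩
        obtain ⟨a, x, h⟩ := hnot m h1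
        rw [hg] at h
        cases h
      · by_cases h2 : P (m + k)
        · rw [if_neg h1, if_pos h2, zero_add]
        · rw [if_neg h1, if_neg h2, add_zero]
          exact cocompVal_window_mul_eq_zero K d hc hi ((exists_eq_inr_comp _).resolve_left h1)
            ((exists_eq_inr_comp _).resolve_left h2)
    have hshift : ∑ m, (if P (m + k) then t m else 0) = ∑ m, if P m then t (m - k) else 0 := by
      rw [← Equiv.sum_comp (Equiv.addRight (k : ZMod (2 * k + 1)))
        fun m => if P m then t (m - k) else 0]
      simp
    rw [Finset.sum_congr rfl fun m _ => hsplit m, Finset.sum_add_distrib, hshift,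
      ← Finset.sum_add_distrib]
    refine Finset.sum_eq_zero fun m _ => ?_
    by_cases h : P m
    · obtain ⟨g, hg⟩ := id h
      rw [if_pos h, if_pos h, ht]
      simp only [sub_add_cancel]
      exact cocompVal_window_add_eq_zero K d hg (hnot m h) (hnot' m h)
    · rw [if_neg h, if_neg h, add_zero]

/-- The partial cocomposition. -/
def cocomp (hk : 0 < k) (I J : Type u) : OSAlgebra K k d (I ⊕ J) →ₐ[K]
    GradedTensorProduct K (degree K k d (Option I)) (degree K k d J) :=
  lift K k d (fun s => cocompVal K k d s) <| lift_rel K k d _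
    (fun σ s => cocompVal_perm K k d σ s)
    (fun s t => cocompVal_mul_comm K k d s t)
    (fun s t h => by
      rw [Set.one_lt_ncard_iff ((Set.finite_range s).inter_of_left _)] at h
      obtain ⟨x, y, hx, hy, hxy⟩ := h
      exact cocompVal_mul_eq_zero K d hxy hx hy)
    (fun i => cocompVal_cyclic K d hk i.injective)

theorem cocomp_ω (hk : 0 < k) (s : Fin (k + 1) ↪ I ⊕ J) :
    cocomp K d hk I J (ω K k d s) = cocompVal K k d s :=
  lift_ω K k d _ _ s

theorem cocomp_ωOf (hk : 0 < k) (f : Fin (k + 1) → I ⊕ J) :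
    cocomp K d hk I J (ωOf K k d f) = cocompVal K k d f := by
  by_cases h : Function.Injective f
  · lift f to Fin (k + 1) ↪ I ⊕ J using h
    rw [ωOf_coe, cocomp_ω]
  · rw [ωOf_of_not_injective K d h, map_zero]
    rcases exists_eq_inr_comp f with ⟨g, rfl⟩ | hf
    · rw [cocompVal_inr, ωOf_of_not_injective K d fun hg => h (Sum.inr_injective.comp hg),
        tmul_zero_right]
    · rw [cocompVal_of_inl K d hf, ωOf_of_not_injective K d fun hg => h hg.of_comp, tmul_zero_left]

end OSAlgebra

/-! ### The four-case rule: validity and uniqueness -/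

namespace OSAlgebra

open GradedTensorProduct

variable (K : Type v) [Field K] {k : ℕ} (d : ℤ) {I J L : Type u}

theorem cocomp_inr (hk : 0 < k) (s : Fin (k + 1) ↪ J) :
    cocomp K d hk I J (ω K k d (s.trans Function.Embedding.inr)) = tmul K 1 (ω K k d s) := by
  rw [cocomp_ω, ← ωOf_coe K k d s, ← cocompVal_inr]
  rfl

theorem cocomp_contract (hk : 0 < k) {s : Fin (k + 1) ↪ I ⊕ J} {t : Fin (k + 1) ↪ Option I}
    (h : ∃ a i, s a = Sum.inl i) (hst : ∀ a, contract (s a) = t a) :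
    cocomp K d hk I J (ω K k d s) = tmul K (ω K k d t) 1 := by
  rw [cocomp_ω, cocompVal_of_inl K d h, ← ωOf_coe K k d t]
  exact congrArg (fun f => tmul K (ωOf K k d f) 1) (funext hst)

theorem cocompositionRule_cocomp (hk : 0 < k) :
    CocompositionRule K k d I J (cocomp K d hk I J) where
  left s := cocomp_contract K d hk ⟨0, s 0, rfl⟩ fun _ => rfl
  right s := cocomp_inr K d hk s
  single s t a j hs ht h := by
    -- Since k > 0 there is a second entry; it lies in I, so S is not contained in J.
    obtain ⟨b, hb⟩ : ∃ b : Fin (k + 1), b ≠ a :=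
      have : Nontrivial (Fin (k + 1)) := Fin.nontrivial_iff_two_le.2 (by omega)
      exists_ne a
    obtain ⟨i, hi, -⟩ := h b hb
    refine cocomp_contract K d hk ⟨b, i, hi⟩ fun c => ?_
    by_cases hc : c = a
    · rw [hc, hs, ht]
      rfl
    · obtain ⟨i, hi, hti⟩ := h c hc
      rw [hi, hti]
      rfl
  zero s h1 h2 := by
    obtain ⟨_, ⟨a, rfl⟩, i, hi⟩ := Set.nonempty_of_ncard_ne_zero (Nat.one_le_iff_ne_zero.1 h1)
    obtain ⟨_, _, ⟨⟨b, rfl⟩, j, hb⟩, ⟨⟨c, rfl⟩, j', hc⟩, hne⟩ :=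
      (Set.one_lt_ncard_iff ((Set.finite_range s).inter_of_left _)).1 h2
    rw [cocomp_ω, cocompVal_of_inl K d ⟨a, i, hi.symm⟩, ωOf_of_not_injective, tmul_zero_left]
    intro hinj
    refine hne (congrArg s (hinj ?_))
    simp [← hb, ← hc, contract]

/-- The cases are exhaustive: S lies in J; or contraction is injective on S, with or without * in
the image; or S meets I and two of its points are contracted together. -/
theorem CocompositionRule.eq {φ ψ : OSAlgebra K k d (I ⊕ J) →ₐ[K]
      GradedTensorProduct K (degree K k d (Option I)) (degree K k d J)}
    (hφ : CocompositionRule K k d I J φ) (hψ : CocompositionRule K k d I J ψ) : φ = ψ := by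
  refine algHom_ext fun s => ?_
  rcases exists_eq_inr_comp s with ⟨g, hg⟩ | ⟨a, i, hi⟩
  · have hs : s = (⟨g, (hg ▸ s.injective).of_comp⟩ : Fin (k + 1) ↪ J).trans
        Function.Embedding.inr := DFunLike.coe_injective hg
    rw [hs, hφ.right, hψ.right]
  · by_cases hc : Function.Injective (contract ∘ s)
    · by_cases hn : ∃ b, contract (s b) = none
      · obtain ⟨b, hb⟩ := hn
        obtain ⟨j, hj⟩ := contract_eq_none.1 hb
        have h : ∀ c, c ≠ b → ∃ i, s c = Sum.inl i ∧ contract (s c) = some i := by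
          intro c hcb
          obtain ⟨i, hi⟩ := contract_ne_none.1
            fun h => hcb (hc (h.trans hb.symm : (contract ∘ s) c = (contract ∘ s) b))
          exact ⟨i, hi, by rw [hi]; rfl⟩
        rw [hφ.single s ⟨_, hc⟩ b j hj hb h, hψ.single s ⟨_, hc⟩ b j hj hb h]
      · push Not at hn
        choose g hg using fun b => contract_ne_none.1 (hn b)
        have hs : s = (⟨g, (funext hg : ⇑s = Sum.inl ∘ g) ▸ s.injective |>.of_comp⟩ :
            Fin (k + 1) ↪ I).trans Function.Embedding.inl := DFunLike.coe_injective (funext hg)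
        rw [hs, hφ.left, hψ.left]
    · obtain ⟨b, c, hbc, hne⟩ : ∃ b c, contract (s b) = contract (s c) ∧ b ≠ c := by
        simpa [Function.Injective] using hc
      have hr : ∃ x y, s b = Sum.inr x ∧ s c = Sum.inr y := by
        rcases hb : s b with x | x <;> rcases hc : s c with y | y <;> rw [hb, hc] at hbc
        · simp only [contract, Sum.elim_inl, Option.some.injEq] at hbc
          exact (hne (s.injective (hb.trans (hbc ▸ hc.symm)))).elim
        · simp [contract] at hbc
        · simp [contract] at hbc
        · exact ⟨x, y, rfl, rfl⟩
      obtain ⟨x, y, hx, hy⟩ := hr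
      have h1 : 1 ≤ (Set.range s ∩ Set.range (Sum.inl : I → I ⊕ J)).ncard := by
        refine (Set.ncard_pos ((Set.finite_range s).inter_of_left _)).2 ?_
        exact ⟨s a, ⟨a, rfl⟩, i, hi.symm⟩
      have h2 : 2 ≤ (Set.range s ∩ Set.range (Sum.inr : J → I ⊕ J)).ncard :=
        (Set.one_lt_ncard_iff ((Set.finite_range s).inter_of_left _)).2
          ⟨s b, s c, ⟨⟨b, rfl⟩, x, hx.symm⟩, ⟨⟨c, rfl⟩, y, hy.symm⟩, s.injective.ne hne⟩
      rw [hφ.zero s h1 h2, hψ.zero s h1 h2]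

/-! ### The structure maps and multiplication by a generator -/

/-- The partial cocomposition as a linear map to the ungraded tensor product. -/
def cocompLin (hk : 0 < k) (I J : Type u) :
    OSAlgebra K k d (I ⊕ J) →ₗ[K] OSAlgebra K k d (Option I) ⊗[K] OSAlgebra K k d J :=
  (GradedTensorProduct.of K _ _).symm.toLinearMap ∘ₗ (cocomp K d hk I J).toLinearMap

theorem of_symm_tmul_one_mul (x : OSAlgebra K k d I)
    (z : GradedTensorProduct K (degree K k d I) (degree K k d J)) :
    (GradedTensorProduct.of K _ _).symm (tmul K x 1 * z) =
      TensorProduct.map (LinearMap.mulLeft K x) LinearMap.id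
        ((GradedTensorProduct.of K _ _).symm z) := by
  obtain ⟨z, rfl⟩ := (GradedTensorProduct.of K _ _).surjective z
  induction z with
  | zero => simp
  | add z z' h h' => simp only [map_add, mul_add, h, h']
  | tmul a b =>
    have h : (tmul K a b : GradedTensorProduct K (degree K k d I) (degree K k d J)) =
      tmul K a 1 * tmul K 1 b := (tmul_one_mul_one_tmul _ _ a b).symm
    change (GradedTensorProduct.of K _ _).symm (_ * tmul K a b) = _
    rw [h, ← mul_assoc, tmul_one_mul_tmul_one, tmul_one_mul_one_tmul]
    simp

/-- Moving x past a left factor of degree m costs (-1)^{(kd-1)m}, which is the effect of `parity` on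
that factor. -/
theorem of_symm_one_tmul_mul {x : OSAlgebra K k d J} (hx : x ∈ degree K k d J (k * d - 1))
    (z : GradedTensorProduct K (degree K k d I) (degree K k d J)) :
    (GradedTensorProduct.of K _ _).symm (tmul K 1 x * z) =
      TensorProduct.map (parity K k d).toLinearMap (LinearMap.mulLeft K x)
        ((GradedTensorProduct.of K _ _).symm z) := by
  obtain ⟨z, rfl⟩ := (GradedTensorProduct.of K _ _).surjective z
  induction z with
  | zero => simp
  | add z z' h h' => simp only [map_add, mul_add, h, h']
  | tmul a b =>
    induction a using DirectSum.Decomposition.inductionOn (degree K k d I) with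
    | zero => simp
    | add a a' h h' => simp only [TensorProduct.add_tmul, map_add, mul_add, h, h']
    | @homogeneous m a =>
      have h := tmul_coe_mul_coe_tmul (R := K) (degree K k d I) (degree K k d J) 1 ⟨x, hx⟩ a b
      rw [one_mul] at h
      refine (congrArg (GradedTensorProduct.of K _ _).symm h).trans ?_
      rw [← tmul_units_smul_left]
      simp [parity_of_mem K k d a.2]

theorem cocompLin_one (hk : 0 < k) : cocompLin K d hk I J 1 = 1 ⊗ₜ 1 := by
  simp only [cocompLin, LinearMap.comp_apply, AlgHom.toLinearMap_apply, map_one]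
  rfl

theorem intertwines_cocompLin_inr (hk : 0 < k) {f : Fin (k + 1) → I ⊕ J} {g : Fin (k + 1) → J}
    (h : ∀ a, f a = Sum.inr (g a)) :
    LinearMap.Intertwines (cocompLin K d hk I J) (LinearMap.mulLeft K (ωOf K k d f))
      (TensorProduct.map (parity K k d).toLinearMap (LinearMap.mulLeft K (ωOf K k d g))) := by
  obtain rfl : f = Sum.inr ∘ g := funext h
  refine ⟨fun a => ?_⟩
  simp only [cocompLin, LinearMap.comp_apply, AlgHom.toLinearMap_apply, LinearMap.mulLeft_apply,
    map_mul, cocomp_ωOf, cocompVal_inr]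
  exact of_symm_one_tmul_mul K d (ωOf_mem K k d g) _

theorem intertwines_cocompLin_inl (hk : 0 < k) {f : Fin (k + 1) → I ⊕ J}
    {g : Fin (k + 1) → Option I} (hf : ∃ a i, f a = Sum.inl i) (h : ∀ a, contract (f a) = g a) :
    LinearMap.Intertwines (cocompLin K d hk I J) (LinearMap.mulLeft K (ωOf K k d f))
      (TensorProduct.map (LinearMap.mulLeft K (ωOf K k d g)) LinearMap.id) := by
  obtain rfl : contract ∘ f = g := funext h
  refine ⟨fun a => ?_⟩
  simp only [cocompLin, LinearMap.comp_apply, AlgHom.toLinearMap_apply, LinearMap.mulLeft_apply,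
    map_mul, cocomp_ωOf, cocompVal_of_inl K d hf]
  exact of_symm_tmul_one_mul K d _ _

theorem koszulSwap_apply (z : OSAlgebra K k d I ⊗[K] OSAlgebra K k d J) :
    koszulSwap (degree K k d I) (degree K k d J) z = (GradedTensorProduct.of K _ _).symm
      (GradedTensorProduct.comm (degree K k d I) (degree K k d J)
        (GradedTensorProduct.of K _ _ z)) := rfl

theorem koszulSwap_one : koszulSwap (degree K k d I) (degree K k d J) (1 ⊗ₜ 1) = 1 ⊗ₜ 1 := by
  have h : GradedTensorProduct.comm (degree K k d I) (degree K k d J) 1 = 1 := map_one _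
  exact congrArg (GradedTensorProduct.of K _ _).symm h

/-- The Koszul symmetry is an algebra isomorphism sending x ⊗ 1 to 1 ⊗ x; translate both left
multiplications into operators on the ordinary tensor product. -/
theorem intertwines_koszulSwap_left {x : OSAlgebra K k d I}
    (hx : x ∈ degree K k d I (k * d - 1)) :
    LinearMap.Intertwines (koszulSwap (degree K k d I) (degree K k d J))
      (TensorProduct.map (LinearMap.mulLeft K x) LinearMap.id)
      (TensorProduct.map (parity K k d).toLinearMap (LinearMap.mulLeft K x)) := by
  refine ⟨fun z => ?_⟩
  have h1 := of_symm_tmul_one_mul K d x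
    (GradedTensorProduct.of K (degree K k d I) (degree K k d J) z)
  rw [of_symm_of] at h1
  have h2 : GradedTensorProduct.comm (degree K k d I) (degree K k d J) (tmul K x 1) =
      tmul K 1 x := by
    have := comm_coe_tmul_coe (R := K) (degree K k d I) (degree K k d J) ⟨x, hx⟩
      ⟨1, SetLike.GradedOne.one_mem⟩
    simpa using this
  rw [← h1, koszulSwap_apply, koszulSwap_apply, symm_of_of, map_mul, h2]
  exact of_symm_one_tmul_mul K d hx _

theorem intertwines_koszulSwap_right {x : OSAlgebra K k d J}
    (hx : x ∈ degree K k d J (k * d - 1)) :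
    LinearMap.Intertwines (koszulSwap (degree K k d I) (degree K k d J))
      (TensorProduct.map (parity K k d).toLinearMap (LinearMap.mulLeft K x))
      (TensorProduct.map (LinearMap.mulLeft K x) LinearMap.id) := by
  refine ⟨fun z => ?_⟩
  have h1 := of_symm_one_tmul_mul K d hx
    (GradedTensorProduct.of K (degree K k d I) (degree K k d J) z)
  rw [of_symm_of] at h1
  have h2 : GradedTensorProduct.comm (degree K k d I) (degree K k d J) (tmul K 1 x) =
      tmul K x 1 := by
    have := comm_coe_tmul_coe (R := K) (degree K k d I) (degree K k d J)
      ⟨1, SetLike.GradedOne.one_mem⟩ ⟨x, hx⟩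
    simpa using this
  rw [← h1, koszulSwap_apply, koszulSwap_apply, symm_of_of, map_mul, h2]
  exact of_symm_tmul_one_mul K d _ _

end OSAlgebra

/-! ### Compatibility of the cocomposition with degree and parity -/

theorem map_mem_tensorDegree {K : Type v} {A B : Type w} [Field K] [Ring A] [Algebra K A] [Ring B]
    [Algebra K B] {𝒜 : ℤ → Submodule K A} {ℬ : ℤ → Submodule K B} {f : A →ₗ[K] A} {g : B →ₗ[K] B}
    {p q m : ℤ} (hf : ∀ i, ∀ a ∈ 𝒜 i, f a ∈ 𝒜 (p + i)) (hg : ∀ j, ∀ b ∈ ℬ j, g b ∈ ℬ (q + j))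
    {z : A ⊗[K] B} (hz : z ∈ tensorDegree 𝒜 ℬ m) :
    TensorProduct.map f g z ∈ tensorDegree 𝒜 ℬ (p + q + m) := by
  induction hz using Submodule.span_induction with
  | mem x h =>
    obtain ⟨i, j, rfl, a, ha, b, hb, rfl⟩ := h
    exact Submodule.subset_span ⟨p + i, q + j, by ring, f a, hf i a ha, g b, hg j b hb, rfl⟩
  | zero => simp
  | add x y _ _ hx hy => rw [map_add]; exact add_mem hx hy
  | smul c x _ hx => rw [map_smul]; exact Submodule.smul_mem _ c hx

namespace OSAlgebra

variable (K : Type v) [Field K] {k : ℕ} (d : ℤ) {I I' J J' L : Type u}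

theorem cocompLin_mem (hk : 0 < k) {n : ℤ} {a : OSAlgebra K k d (I ⊕ J)}
    (ha : a ∈ degree K k d (I ⊕ J) n) :
    cocompLin K d hk I J a ∈ tensorDegree (degree K k d (Option I)) (degree K k d J) n := by
  have hmul : ∀ {X : Type u} (f : Fin (k + 1) → X) (i : ℤ), ∀ x ∈ degree K k d X i,
      LinearMap.mulLeft K (ωOf K k d f) x ∈ degree K k d X (k * d - 1 + i) :=
    fun f i x hx => SetLike.mul_mem_graded (ωOf_mem K k d f) hx
  induction ha using Submodule.span_induction with
  | mem x h =>
    obtain ⟨l, rfl, rfl⟩ := h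
    induction l with
    | nil =>
      rw [List.map_nil, List.prod_nil, cocompLin_one]
      exact Submodule.subset_span ⟨0, 0, by simp, 1, SetLike.GradedOne.one_mem, 1,
        SetLike.GradedOne.one_mem, rfl⟩
    | cons s l ih =>
      have hdeg : (((s :: l).length : ℕ) : ℤ) * (k * d - 1) =
          (k * d - 1) + (l.length : ℤ) * (k * d - 1) := by
        rw [List.length_cons]
        push_cast
        ring
      rw [List.map_cons, List.prod_cons, ← ωOf_coe, hdeg]
      rcases exists_eq_inr_comp s with ⟨g, hg⟩ | hs
      · rw [← LinearMap.mulLeft_apply K (ωOf K k d s),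
          -- The operator has bidegree (0, kd-1), as `parity` preserves degrees.
          (intertwines_cocompLin_inr K d hk (congrFun hg)).apply, ← zero_add (k * d - 1 : ℤ)]
        refine map_mem_tensorDegree (fun i x hx => ?_) (hmul g) (by simpa using ih)
        rw [zero_add]
        exact parity_mem K k d hx
      · rw [← LinearMap.mulLeft_apply K (ωOf K k d s),
          (intertwines_cocompLin_inl K d hk hs fun _ => rfl).apply, ← add_zero (k * d - 1 : ℤ)]
        refine map_mem_tensorDegree (hmul _) (fun i x hx => ?_) (by simpa using ih)
        rwa [zero_add]
  | zero => simp
  | add x y _ _ hx hy => rw [map_add]; exact add_mem hx hy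
  | smul c x _ hx => rw [map_smul]; exact Submodule.smul_mem _ c hx

/-- Used in coassociativity: a generator in the right factor leaves `parity` on the left one, which
the next cocomposition must split as `parity` ⊗ `parity`. -/
theorem intertwines_cocompLin_parity (hk : 0 < k) :
    LinearMap.Intertwines (cocompLin K d hk I J) (parity K k d).toLinearMap
      (TensorProduct.map (parity K k d).toLinearMap (parity K k d).toLinearMap) := by
  refine ⟨LinearMap.congr_fun (f := cocompLin K d hk I J ∘ₗ (parity K k d).toLinearMap)
    (g := TensorProduct.map (parity K k d).toLinearMap (parity K k d).toLinearMap ∘ₗ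
      cocompLin K d hk I J) (linearMap_ext ?_ fun s => ?_)⟩
  · simp only [LinearMap.comp_apply, AlgHom.toLinearMap_apply, map_one, cocompLin_one,
      TensorProduct.map_tmul]
  · rw [← ωOf_coe]
    have hpar := fun f : Fin (k + 1) → I ⊕ J => intertwines_parity_ωOf K k d f
    rcases exists_eq_inr_comp s with ⟨g, hg⟩ | hs
    · have h := intertwines_cocompLin_inr K d hk (congrFun hg)
      refine ⟨_, (hpar s).trans (h.units_smul _), h.trans ?_⟩
      rw [← LinearMap.tensorProduct_map_units_smul_right]
      exact .tensor ⟨fun _ => rfl⟩ (intertwines_parity_ωOf K k d g)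
    · have h := intertwines_cocompLin_inl K d hk hs fun _ => rfl
      refine ⟨_, (hpar s).trans (h.units_smul _), h.trans ?_⟩
      rw [← LinearMap.tensorProduct_map_units_smul_left]
      exact .tensor (intertwines_parity_ωOf K k d _) (.id_id _)

/-! ### Coherence -/

theorem cocompLin_map (hk : 0 < k) (e : I ≃ I') (f : J ≃ J') :
    cocompLin K d hk I' J' ∘ₗ (map K k d (Equiv.sumCongr e f).toEmbedding).toLinearMap =
      TensorProduct.map (map K k d (Equiv.optionCongr e).toEmbedding).toLinearMap
        (map K k d f.toEmbedding).toLinearMap ∘ₗ cocompLin K d hk I J := by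
  refine linearMap_ext (by simp [cocompLin_one]) fun s => ?_
  rw [← ωOf_coe]
  rcases exists_eq_inr_comp s with ⟨g, hg⟩ | hs
  · refine ⟨_, (intertwines_map_ωOf K d (g := Sum.inr ∘ f ∘ g) fun a => ?_).trans
        (intertwines_cocompLin_inr K d hk fun _ => rfl),
      (intertwines_cocompLin_inr K d hk (congrFun hg)).trans
        (.tensor (intertwines_map_parity K k d _) (intertwines_map_ωOf K d fun _ => rfl))⟩
    rw [hg]
    rfl
  · refine ⟨_, (intertwines_map_ωOf K d fun _ => rfl).trans
        (intertwines_cocompLin_inl K d hk (g := Equiv.optionCongr e ∘ contract ∘ s) ?_ fun a => ?_),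
      (intertwines_cocompLin_inl K d hk hs fun _ => rfl).trans
        (.tensor (intertwines_map_ωOf K d fun _ => rfl) (.id_id _))⟩
    · obtain ⟨b, i, hi⟩ := hs
      exact ⟨b, e i, by simp [hi]⟩
    · simp only [Function.comp_apply]
      rcases s a with x | x <;> rfl

theorem cocompLin_counit_left (hk : 0 < k) (e : Option PEmpty.{u + 1} ↪ L) (J : Type u) :
    (TensorProduct.lid K (OSAlgebra K k d J)).toLinearMap ∘ₗ
        TensorProduct.map ((augmentation K k d).toLinearMap ∘ₗ (map K k d e).toLinearMap)
          LinearMap.id ∘ₗ cocompLin K d hk PEmpty.{u + 1} J =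
      (map K k d (Equiv.emptySum PEmpty.{u + 1} J).toEmbedding).toLinearMap := by
  refine linearMap_ext (by simp [cocompLin_one]) fun s => ?_
  rw [← ωOf_coe]
  rcases exists_eq_inr_comp s with ⟨g, hg⟩ | ⟨-, i, -⟩
  · exact ⟨_, ((intertwines_cocompLin_inr K d hk (congrFun hg)).trans
      (.tensor ((intertwines_map_parity K k d e).trans (intertwines_augmentation_parity K k d))
        (.refl _))).trans (.lid _), intertwines_map_ωOf K d fun a => by rw [hg]; rfl⟩
  · exact i.elim

theorem cocompLin_counit_right (hk : 0 < k) (I : Type u) :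
    (TensorProduct.rid K (OSAlgebra K k d (Option I))).toLinearMap ∘ₗ
        TensorProduct.map LinearMap.id (augmentation K k d).toLinearMap ∘ₗ
        cocompLin K d hk I PUnit.{u + 1} =
      (map K k d (Equiv.optionEquivSumPUnit.{u} I).symm.toEmbedding).toLinearMap := by
  refine linearMap_ext (by simp [cocompLin_one]) fun s => ?_
  -- At least two distinct entries cannot all lie in a one-point set.
  have hs : ∃ a i, s a = Sum.inl i := by
    refine (exists_eq_inr_comp s).resolve_left ?_
    rintro ⟨g, hg⟩
    have := s.injective (a₁ := 0) (a₂ := Fin.last k) (by rw [hg]; rfl)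
    rw [Fin.ext_iff, Fin.val_zero, Fin.val_last] at this
    omega
  rw [← ωOf_coe]
  refine ⟨_, ((intertwines_cocompLin_inl K d hk hs fun _ => rfl).trans
    (.tensor (.refl _) (.id_id _))).trans (.rid _), intertwines_map_ωOf K d fun a => ?_⟩
  rcases s a with x | x <;> rfl

theorem cocompLin_coassoc_seq (hk : 0 < k) (I J L : Type u) :
    TensorProduct.map LinearMap.id (cocompLin K d hk J L) ∘ₗ cocompLin K d hk I (J ⊕ L) =
      (TensorProduct.assoc K _ _ _).toLinearMap ∘ₗ
        TensorProduct.map (cocompLin K d hk I (Option J) ∘ₗ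
          (map K k d (optionSumRight I J).toEmbedding).toLinearMap) LinearMap.id ∘ₗ
        cocompLin K d hk (I ⊕ J) L ∘ₗ
        (map K k d (Equiv.sumAssoc I J L).symm.toEmbedding).toLinearMap := by
  refine linearMap_ext (by simp [cocompLin_one]) fun s => ?_
  rw [← ωOf_coe]
  -- According to whether S lies in L, lies in J ⊔ L and meets J, or meets I, both sides give
  -- `parity` ⊗ (`parity` ⊗ (ω·)), `parity` ⊗ ((ω·) ⊗ id) or (ω·) ⊗ id.
  rcases exists_eq_inr_comp s with ⟨g, hg⟩ | hs
  · rcases exists_eq_inr_comp g with ⟨g, rfl⟩ | ⟨b, j, hj⟩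
    · exact ⟨_, (intertwines_cocompLin_inr K d hk (congrFun hg)).trans
          (.tensor (.refl _) (intertwines_cocompLin_inr K d hk fun _ => rfl)),
        (((intertwines_map_ωOf K d fun _ => rfl).trans
          (intertwines_cocompLin_inr K d hk fun a => by rw [hg]; rfl)).trans
          (.tensor ((intertwines_map_parity K k d _).trans (intertwines_cocompLin_parity K d hk))
            (.refl _))).trans (.assoc _ _ _)⟩
    · refine ⟨_, (intertwines_cocompLin_inr K d hk (congrFun hg)).trans
          (.tensor (.refl _) (intertwines_cocompLin_inl K d hk ⟨b, j, hj⟩ fun _ => rfl)),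
        (((intertwines_map_ωOf K d fun _ => rfl).trans
          (intertwines_cocompLin_inl K d hk ⟨b, Sum.inr j, by simp [hg, hj]⟩ fun _ => rfl)).trans
          (.tensor ((intertwines_map_ωOf K d fun _ => rfl).trans
            (intertwines_cocompLin_inr K d hk fun a => ?_)) (.id_id _))).trans (.assoc _ _ _)⟩
      rw [hg]
      simp only [Function.comp_apply]
      rcases g a with x | x <;> rfl
  · obtain ⟨b, i, hi⟩ := id hs
    refine ⟨_, (intertwines_cocompLin_inl K d hk hs fun _ => rfl).trans
        (.tensor (.refl _) (.id_id _)),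
      (((intertwines_map_ωOf K d fun _ => rfl).trans
        (intertwines_cocompLin_inl K d hk ⟨b, Sum.inl i, by simp [hi]⟩ fun _ => rfl)).trans
        (.tensor ((intertwines_map_ωOf K d fun _ => rfl).trans
          (intertwines_cocompLin_inl K d hk ⟨b, i, by simp [hi, contract, optionSumRight]⟩
            fun a => ?_)) (.id_id _))).trans (.assoc_left _)⟩
    rcases s a with x | x | x <;> rfl

theorem cocompLin_coassoc_par (hk : 0 < k) (I J L : Type u) :
    (TensorProduct.assoc K _ _ _).toLinearMap ∘ₗ
        TensorProduct.map (cocompLin K d hk (Option I) J ∘ₗ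
          (map K k d (optionSumLeft I J).toEmbedding).toLinearMap) LinearMap.id ∘ₗ
        cocompLin K d hk (I ⊕ J) L =
      TensorProduct.map (map K k d (optionSwap I).toEmbedding).toLinearMap
          (koszulSwap (degree K k d L) (degree K k d J)) ∘ₗ
        (TensorProduct.assoc K _ _ _).toLinearMap ∘ₗ
        TensorProduct.map (cocompLin K d hk (Option I) L ∘ₗ
          (map K k d (optionSumLeft I L).toEmbedding).toLinearMap) LinearMap.id ∘ₗ
        cocompLin K d hk (I ⊕ L) J ∘ₗ
        (map K k d (sumRightComm I J L).toEmbedding).toLinearMap := by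
  refine linearMap_ext (by simp [cocompLin_one, koszulSwap_one]) fun s => ?_
  rw [← ωOf_coe]
  -- The cases are S inside L, S inside J, and neither. In the last case both sides act on the outer
  -- left factor only, and the two contracted lists agree after exchanging the extra points;
  -- repetitions need no separate treatment.
  rcases exists_eq_inr_comp s with ⟨g, hg⟩ | hs
  · exact ⟨_, ((intertwines_cocompLin_inr K d hk (congrFun hg)).trans
        (.tensor ((intertwines_map_parity K k d _).trans (intertwines_cocompLin_parity K d hk))
          (.refl _))).trans (.assoc _ _ _),
      ((((intertwines_map_ωOf K d fun _ => rfl).trans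
        (intertwines_cocompLin_inl K d hk ⟨0, Sum.inr (g 0), by simp [hg, sumRightComm]⟩
          fun _ => rfl)).trans
        (.tensor ((intertwines_map_ωOf K d fun _ => rfl).trans
          (intertwines_cocompLin_inr K d hk fun a => by rw [hg]; rfl)) (.id_id _))).trans
        (.assoc _ _ _)).trans
        (.tensor (intertwines_map_parity K k d _)
          (intertwines_koszulSwap_left K d (ωOf_mem K k d g)))⟩
  obtain ⟨c, y, hc⟩ := id hs
  rcases exists_eq_inr_comp ((sumRightComm I J L) ∘ s) with ⟨g, hg⟩ | hs'
  · refine ⟨_, ((intertwines_cocompLin_inl K d hk hs fun _ => rfl).trans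
        (.tensor ((intertwines_map_ωOf K d fun _ => rfl).trans
          (intertwines_cocompLin_inr K d hk fun a => ?_)) (.id_id _))).trans (.assoc _ _ _),
      ((((intertwines_map_ωOf K d fun _ => rfl).trans
        (intertwines_cocompLin_inr K d hk (congrFun hg))).trans
        (.tensor ((intertwines_map_parity K k d _).trans (intertwines_cocompLin_parity K d hk))
          (.refl _))).trans (.assoc _ _ _)).trans
        (.tensor (intertwines_map_parity K k d _)
          (intertwines_koszulSwap_right K d (ωOf_mem K k d g)))⟩
    have ha := congrFun hg a
    simp only [Function.comp_apply] at ha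
    rw [← Equiv.eq_symm_apply] at ha
    rw [ha]
    rfl
  · obtain ⟨b, x, hb⟩ := id hs'
    rw [Function.comp_apply, ← Equiv.eq_symm_apply] at hb
    refine ⟨_, ((intertwines_cocompLin_inl K d hk hs fun _ => rfl).trans
        (.tensor ((intertwines_map_ωOf K d fun _ => rfl).trans
          (intertwines_cocompLin_inl K d hk ?_ fun _ => rfl)) (.id_id _))).trans (.assoc_left _),
      ((((intertwines_map_ωOf K d fun _ => rfl).trans
        (intertwines_cocompLin_inl K d hk hs' fun _ => rfl)).trans
        (.tensor ((intertwines_map_ωOf K d fun _ => rfl).trans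
          (intertwines_cocompLin_inl K d hk ?_ fun _ => rfl)) (.id_id _))).trans
        (.assoc_left _)).trans
        (.tensor (intertwines_map_ωOf K d fun a => ?_) (.id_id _))⟩
    · refine ⟨b, ?_⟩
      rw [hb]
      rcases x with x | x
      exacts [⟨some x, rfl⟩, ⟨none, rfl⟩]
    · refine ⟨c, ?_⟩
      rw [hc]
      rcases y with y | y
      exacts [⟨some y, rfl⟩, ⟨none, rfl⟩]
    · rcases s a with (x | x) | x <;> rfl

/-- The Hopf cooperad `𝒜^k_d`. -/
def hopfCooperad (hk : 0 < k) : HopfCooperad K (fun I : Type u => OSAlgebra K k d I)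
    (fun I => degree K k d I) where
  relabel e := map K k d e.toEmbedding
  cocomp I J _ _ := cocomp K d hk I J
  counit := augmentation K k d
  graded_comm _ _ _ _ _ ha _ hb := mul_comm_of_mem K k d ha hb
  relabel_mem e _ _ ha := map_mem K k d e.toEmbedding ha
  cocomp_mem _ _ _ _ _ _ ha := cocompLin_mem K d hk ha
  counit_eq_zero _ hn _ ha := augmentation_of_mem K k d hn ha
  relabel_refl _ _ := algHom_ext fun s => map_ω K k d _ s
  relabel_trans _ _ := algHom_ext fun s => by simp [Function.Embedding.trans_assoc]
  cocomp_relabel e f := cocompLin_map K d hk e f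
  counit_left J _ := cocompLin_counit_left K d hk _ J
  counit_right I _ := cocompLin_counit_right K d hk I
  coassoc_seq I J L _ _ _ := cocompLin_coassoc_seq K d hk I J L
  coassoc_par I J L _ _ _ := cocompLin_coassoc_par K d hk I J L

end OSAlgebra

/-! ### Uniqueness and the main theorem -/

theorem HopfCooperad.ext_ops {K : Type v} [Field K] {A : Type u → Type w} [∀ I, Ring (A I)]
    [∀ I, Algebra K (A I)] {𝒜 : ∀ I, ℤ → Submodule K (A I)} [∀ I, GradedAlgebra (𝒜 I)]
    {P Q : HopfCooperad K A 𝒜}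
    (relabel : ∀ (I J : Type u) [Finite I] [Finite J] (e : I ≃ J), P.relabel e = Q.relabel e)
    (cocomp : ∀ (I J : Type u) [Finite I] [Finite J], P.cocomp I J = Q.cocomp I J)
    (counit : P.counit = Q.counit) : P = Q := by
  obtain ⟨⟨r, c, ε⟩, _⟩ := P
  obtain ⟨⟨r', c', ε'⟩, _⟩ := Q
  have hr : @r = @r' := by
    funext I J _ _ e
    exact relabel I J e
  have hc : c = c' := by
    funext I J _ _
    exact cocomp I J
  cases hr
  cases hc
  cases counit
  rfl

end

theorem mainTheorem11 (K : Type v) [Field K] (k : ℕ) (hk : 0 < k) (d : ℤ) :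
    ∃! P : HopfCooperad K (fun I : Type u => OSAlgebra K k d I)
        (fun I => OSAlgebra.degree K k d I),
      (∀ (I J : Type u) [Finite I] [Finite J] (e : I ≃ J) (s : Fin (k + 1) ↪ I),
        P.relabel e (OSAlgebra.ω K k d s) = OSAlgebra.ω K k d (s.trans e.toEmbedding)) ∧
      ∀ (I J : Type u) [Finite I] [Finite J],
        OSAlgebra.CocompositionRule K k d I J (P.cocomp I J) := by
  refine ⟨OSAlgebra.hopfCooperad K d hk, ⟨fun I J _ _ e s => OSAlgebra.map_ω K k d _ s,
    fun I J _ _ => OSAlgebra.cocompositionRule_cocomp K d hk⟩, fun P hP => ?_⟩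
  refine HopfCooperad.ext_ops (fun I J _ _ e => OSAlgebra.algHom_ext fun s => ?_)
    (fun I J _ _ => (hP.2 I J).eq K d (OSAlgebra.cocompositionRule_cocomp K d hk))
    (OSAlgebra.algHom_ext fun s => ?_)
  · exact (hP.1 I J e s).trans (OSAlgebra.map_ω K k d _ s).symm
  -- The counits agree vacuously: a generator on a one-point set would force k = 0.
  · have h : (0 : Fin (k + 1)) = Fin.last k := s.injective (Subsingleton.elim _ _)
    rw [Fin.ext_iff, Fin.val_zero, Fin.val_last] at h
    omega
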